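/- Let $D=\mathbb{C}(x)[\partial]$, $\partial=d/dx$, be the ring of linear differential operators with rational function coefficients, and let $\theta=x\partial$. An operator $E\in D$ is called reducible if $E=F\circ G$ with $F,G\in D$ both of positive order. For $e_1,\dots,e_9\in\mathbb{C}$ put $s_{11}=e_1+e_2+e_3$, $s_{12}=e_4+e_5+e_6$, $s_{13}=e_7+e_8+e_9$, $s_{21}=e_1e_2+e_1e_3+e_2e_3$, $s_{22}=e_4e_5+e_4e_6+e_5e_6$, $s_{23}=e_7e_8+e_7e_9+e_8e_9$, $s_{31}=e_1e_2e_3$, $s_{32}=e_4e_5e_6$, $s_{33}=e_7e_8e_9$, $s=-(s_{11}+s_{12}+s_{13}-6)/3$, and let $E_6(e_1,\dots,e_9)=T_0+T_1\partial+T_2\partial^2+T_3\partial^3=x^3(x-1)^3\partial^6+\cdots$, where $$\begin{aligned} T_0&=(\theta+s+2)(\theta+s+1)(\theta+s)(\theta+e_7)(\theta+e_8)(\theta+e_9),\\ T_1&=(\theta+s+2)(\theta+s+1)(T_{13}\theta^3+T_{12}\theta^2+T_{11}\theta+T_{10}),\\ T_2&=(\theta+s+2)(T_{23}\theta^3+T_{22}\theta^2+T_{21}\theta+T_{20}),\\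 T_3&=-(\theta+3-e_1)(\theta+3-e_2)(\theta+3-e_3), \end{aligned}$$ $$\begin{aligned} T_{13}&=-3,\quad T_{23}=3,\quad T_{12}=-9+s_{11}-2s_{13},\quad T_{22}=18+s_{13}-2s_{11},\\ T_{11}&=-8+\tfrac13(s_{11}^2+2s_{11}s_{13}-s_{12}^2+s_{13}^2)+s_{11}-5s_{13}-s_{21}+s_{22}-2s_{23},\\ T_{21}&=35+\tfrac13(-s_{11}^2-2s_{11}s_{13}+s_{12}^2-s_{13}^2)-7s_{11}+5s_{13}+2s_{21}-s_{22}+s_{23},\\ T_{20}&=-T_{10}+19+\tfrac19(s_{11}^2s_{13}-s_{11}s_{12}^2+s_{11}s_{13}^2-s_{12}^2s_{13})+\tfrac1{27}(s_{13}^3+s_{11}^3-2s_{12}^3)\\ &\quad+\tfrac13(-2s_{11}^2-4s_{11}s_{13}+s_{11}s_{22}+2s_{12}^2+s_{22}s_{12}-2s_{13}^2+s_{22}s_{13})\\ &\quad-5s_{11}+4s_{13}+3s_{21}-2s_{22}-s_{31}-s_{32}-s_{33},\\ 2T_{10}&=\tfrac13(2s_{11}+s_{11}^2+2s_{11}s_{13}-s_{12}^2+s_{13}^2-s_{11}s_{21}+2s_{11}s_{23}+s_{12}s_{22}-2s_{13}s_{21}+2s_{13}s_{22}+s_{13}s_{23}-14s_{13})\\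 &\quad+\tfrac29(s_{11}^2s_{13}-s_{12}^2s_{13})+\tfrac2{27}(s_{11}^3-s_{12}^3)-5-s_{21}+s_{31}+s_{22}-s_{32}-5s_{23}-3s_{33}. \end{aligned}$$ For $a,b,c,g,p,q,r\in\mathbb{C}$ let $S\!E_6(a,b,c,g,p,q,r)=E_6(e_1,\dots,e_9)$ with $$\begin{aligned} e_1&=p+r+1,& e_2&=a+c+p+r+2,& e_3&=2a+2c+g+p+r+3,\\ e_4&=q+r+1,& e_5&=b+c+q+r+2,& e_6&=2b+2c+g+q+r+3,\\ e_7&=-2c-p-q-r-1,& e_8&=-a-b-2c-p-q-r-g-2,& e_9&=-2a-2b-2c-p-q-r-g-3. \end{aligned}$$ **Theorem.** Let $a,b,c,g,p,q,r\in\mathbb{C}$. If one of the numbers $$a,\quad b,\quad c,\quad \tfrac{g-1}2,\quad \tfrac{2a+g}2,\quad \tfrac{2b+g}2,\quad \tfrac{2c+g}2,\quad a+b+c+g,\quad \tfrac{2a+2b+2c+g}2,$$ $$r,\quad e_i-r\ (1\le i\le 6),\quad e_7,\quad e_8,\quad e_9$$ is an integer, then the operator $S\!E_6(a,b,c,g,p,q,r)$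 is reducible. -/

import Mathlib

open Polynomial

noncomputable section

namespace FuchsSE6

/-- The field `ℂ(x)` of rational functions. -/
abbrev K : Type := RatFunc ℂ

/-- The derivative of a rational function `u / v` is `(u' v - u v') / v ^ 2`
(here for the reduced fraction). -/
def derivFun (f : K) : K :=
  (algebraMap ℂ[X] K (derivative f.num) * algebraMap ℂ[X] K f.denom
    - algebraMap ℂ[X] K f.num * algebraMap ℂ[X] K (derivative f.denom))
    / algebraMap ℂ[X] K f.denom ^ 2

/-- The quotient rule holds for every representation of a rational function as a fraction. -/
theorem derivFun_div (u v : ℂ[X]) (hv : v ≠ 0) :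
    derivFun (algebraMap ℂ[X] K u / algebraMap ℂ[X] K v) =
      (algebraMap ℂ[X] K (derivative u) * algebraMap ℂ[X] K v
        - algebraMap ℂ[X] K u * algebraMap ℂ[X] K (derivative v))
        / algebraMap ℂ[X] K v ^ 2 := by
  set f : K := algebraMap ℂ[X] K u / algebraMap ℂ[X] K v with hf
  have hv' : algebraMap ℂ[X] K v ≠ 0 := RatFunc.algebraMap_ne_zero hv
  have hd' : algebraMap ℂ[X] K f.denom ≠ 0 := RatFunc.algebraMap_ne_zero f.denom_ne_zero
  have hcross : f.num * v = u * f.denom := by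
    apply RatFunc.algebraMap_injective ℂ
    rw [map_mul, map_mul]
    have h1 : algebraMap ℂ[X] K f.num / algebraMap ℂ[X] K f.denom
        = algebraMap ℂ[X] K u / algebraMap ℂ[X] K v := f.num_div_denom
    exact (div_eq_div_iff hd' hv').1 h1
  have hder := congrArg derivative hcross
  rw [derivative_mul, derivative_mul] at hder
  have e1 := congrArg (algebraMap ℂ[X] K) hcross
  have e2 := congrArg (algebraMap ℂ[X] K) hder
  simp only [map_add, map_mul] at e1 e2
  unfold derivFun
  rw [div_eq_div_iff (pow_ne_zero 2 hd') (pow_ne_zero 2 hv')]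
  linear_combination
    (algebraMap ℂ[X] K v * algebraMap ℂ[X] K f.denom) * e2
      - (algebraMap ℂ[X] K v * algebraMap ℂ[X] K (derivative f.denom)
        + algebraMap ℂ[X] K f.denom * algebraMap ℂ[X] K (derivative v)) * e1

theorem exists_frac (f : K) :
    ∃ u v : ℂ[X], v ≠ 0 ∧ f = algebraMap ℂ[X] K u / algebraMap ℂ[X] K v :=
  ⟨f.num, f.denom, f.denom_ne_zero, f.num_div_denom.symm⟩

theorem derivFun_mul (f g : K) : derivFun (f * g) = f * derivFun g + g * derivFun f := by
  obtain ⟨u, v, hv, rfl⟩ := exists_frac f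
  obtain ⟨w, z, hz, rfl⟩ := exists_frac g
  have hv' : algebraMap ℂ[X] K v ≠ 0 := RatFunc.algebraMap_ne_zero hv
  have hz' : algebraMap ℂ[X] K z ≠ 0 := RatFunc.algebraMap_ne_zero hz
  rw [div_mul_div_comm, ← map_mul, ← map_mul, derivFun_div _ _ (mul_ne_zero hv hz),
    derivFun_div _ _ hv, derivFun_div _ _ hz]
  simp only [derivative_mul, map_add, map_mul]
  field_simp
  ring

theorem derivFun_add (f g : K) : derivFun (f + g) = derivFun f + derivFun g := by
  obtain ⟨u, v, hv, rfl⟩ := exists_frac f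
  obtain ⟨w, z, hz, rfl⟩ := exists_frac g
  have hv' : algebraMap ℂ[X] K v ≠ 0 := RatFunc.algebraMap_ne_zero hv
  have hz' : algebraMap ℂ[X] K z ≠ 0 := RatFunc.algebraMap_ne_zero hz
  rw [div_add_div _ _ hv' hz', ← map_mul, ← map_mul, ← map_mul, ← map_add,
    derivFun_div _ _ (mul_ne_zero hv hz), derivFun_div _ _ hv, derivFun_div _ _ hz]
  simp only [derivative_mul, map_add, map_mul]
  field_simp
  ring

theorem derivFun_algebraMap (u : ℂ[X]) :
    derivFun (algebraMap ℂ[X] K u) = algebraMap ℂ[X] K (derivative u) := by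
  have h := derivFun_div u 1 one_ne_zero
  simpa using h

theorem derivFun_smul (t : ℂ) (f : K) : derivFun (t • f) = t • derivFun f := by
  have h : ∀ g : K, t • g = algebraMap ℂ[X] K (C t) * g := fun g => by
    rw [Algebra.smul_def]; rfl
  rw [h, h, derivFun_mul, derivFun_algebraMap]
  simp

/-- The derivation `∂ = d/dx` of `ℂ(x)`, as a `ℂ`-linear operator on `ℂ(x)`. -/
def D : Module.End ℂ K where
  toFun := derivFun
  map_add' := derivFun_add
  map_smul' := derivFun_smul

/-- Multiplication by the rational function `f`, as an operator on `ℂ(x)`. -/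
def mulOp (f : K) : Module.End ℂ K := LinearMap.mulLeft ℂ f

/-- The linear differential operator `∑_{i ≤ n} c_i(x) ∂ ^ i`.
The ring `ℂ(x)[∂]` acts faithfully on `ℂ(x)` (see `coeff_eq_zero`) and is identified with its
image in `Module.End ℂ ℂ(x)`; the product `*` there is the composition of operators. -/
def ofCoeffs (n : ℕ) (c : ℕ → K) : Module.End ℂ K :=
  ∑ i ∈ Finset.range (n + 1), mulOp (c i) * D ^ i

/-- `P` belongs to `ℂ(x)[∂]` and has order `n`. -/
def HasOrder (P : Module.End ℂ K) (n : ℕ) : Prop :=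
  ∃ c : ℕ → K, c n ≠ 0 ∧ P = ofCoeffs n c

/-- `E` is reducible in `ℂ(x)[∂]`: it is a composition `E = F ∘ G` of two elements of `ℂ(x)[∂]`,
both of positive order. -/
def IsReducible (E : Module.End ℂ K) : Prop :=
  ∃ (F G : Module.End ℂ K) (m n : ℕ),
    0 < m ∧ 0 < n ∧ HasOrder F m ∧ HasOrder G n ∧ E = F * G

theorem D_pow_X_pow (i k : ℕ) :
    (D ^ i) (algebraMap ℂ[X] K (X ^ k)) = algebraMap ℂ[X] K (derivative^[i] (X ^ k)) := by
  induction i with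
  | zero => simp
  | succ i ih =>
    rw [pow_succ', Module.End.mul_apply, ih, Function.iterate_succ_apply']
    exact derivFun_algebraMap _

/-- The coefficients of an operator in `ℂ(x)[∂]` are determined by its action on `ℂ(x)`. -/
theorem coeff_eq_zero {n : ℕ} {c : ℕ → K} (h : ofCoeffs n c = 0) :
    ∀ i ≤ n, c i = 0 := by
  intro k
  induction k using Nat.strong_induction_on with
  | _ k ih =>
    intro hk
    have h1 : ofCoeffs n c (algebraMap ℂ[X] K (X ^ k)) = 0 := by rw [h]; rfl
    unfold ofCoeffs at h1
    rw [LinearMap.sum_apply, Finset.sum_eq_single k] at h1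
    · rw [Module.End.mul_apply, D_pow_X_pow, iterate_derivative_X_pow_eq_natCast_mul] at h1
      simp only [mulOp, LinearMap.mulLeft_apply, Nat.descFactorial_self, Nat.sub_self, pow_zero,
        mul_one, map_natCast] at h1
      rcases mul_eq_zero.1 h1 with h2 | h2
      · exact h2
      · exact absurd (by exact_mod_cast h2) (Nat.factorial_ne_zero k)
    · intro i hi hik
      rcases lt_or_gt_of_ne hik with hlt | hlt
      · rw [ih i hlt (by have := Finset.mem_range.1 hi; omega)]
        simp [mulOp]
      · rw [Module.End.mul_apply, D_pow_X_pow, iterate_derivative_X_pow_eq_natCast_mul,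
          Nat.descFactorial_of_lt hlt]
        simp
    · intro hk'
      exact absurd (Finset.mem_range.2 (by omega)) hk'

/-- The Euler operator `θ = x ∂`. -/
def theta : Module.End ℂ K := mulOp RatFunc.X * D

/-- The operator `T₀(θ) + T₁(θ) ∂ + T₂(θ) ∂ ^ 2 + T₃(θ) ∂ ^ 3`. -/
def thetaForm (T₀ T₁ T₂ T₃ : ℂ[X]) : Module.End ℂ K :=
  aeval theta T₀ + aeval theta T₁ * D + aeval theta T₂ * D ^ 2 + aeval theta T₃ * D ^ 3

/-- `sym1`, `sym2`, `sym3` are the elementary symmetric polynomials of three exponents. -/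
def sym1 (u v w : ℂ) : ℂ := u + v + w

/-- See `sym1`. -/
def sym2 (u v w : ℂ) : ℂ := u * v + u * w + v * w

/-- See `sym1`. -/
def sym3 (u v w : ℂ) : ℂ := u * v * w

/-- `T₁₁` as a function of `s_{ij}`. -/
def coeffT11 (s₁₁ s₁₂ s₁₃ s₂₁ s₂₂ s₂₃ : ℂ) : ℂ :=
  -8 + (s₁₁ ^ 2 + 2 * s₁₁ * s₁₃ - s₁₂ ^ 2 + s₁₃ ^ 2) / 3 + s₁₁ - 5 * s₁₃ - s₂₁ + s₂₂ - 2 * s₂₃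

/-- `T₂₁` as a function of `s_{ij}`. -/
def coeffT21 (s₁₁ s₁₂ s₁₃ s₂₁ s₂₂ s₂₃ : ℂ) : ℂ :=
  35 + (-s₁₁ ^ 2 - 2 * s₁₁ * s₁₃ + s₁₂ ^ 2 - s₁₃ ^ 2) / 3 - 7 * s₁₁ + 5 * s₁₃ + 2 * s₂₁ - s₂₂ + s₂₃

/-- `T₁₀` as a function of `s_{ij}`. -/
def coeffT10 (s₁₁ s₁₂ s₁₃ s₂₁ s₂₂ s₂₃ s₃₁ s₃₂ s₃₃ : ℂ) : ℂ :=
  ((2 * s₁₁ + s₁₁ ^ 2 + 2 * s₁₁ * s₁₃ - s₁₂ ^ 2 + s₁₃ ^ 2 - s₁₁ * s₂₁ + 2 * s₁₁ * s₂₃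
      + s₁₂ * s₂₂ - 2 * s₁₃ * s₂₁ + 2 * s₁₃ * s₂₂ + s₁₃ * s₂₃ - 14 * s₁₃) / 3
    + 2 * (s₁₁ ^ 2 * s₁₃ - s₁₂ ^ 2 * s₁₃) / 9
    + 2 * (s₁₁ ^ 3 - s₁₂ ^ 3) / 27
    - 5 - s₂₁ + s₃₁ + s₂₂ - s₃₂ - 5 * s₂₃ - 3 * s₃₃) / 2

/-- `T₂₀` as a function of `s_{ij}`. -/
def coeffT20 (s₁₁ s₁₂ s₁₃ s₂₁ s₂₂ s₂₃ s₃₁ s₃₂ s₃₃ : ℂ) : ℂ :=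
  -coeffT10 s₁₁ s₁₂ s₁₃ s₂₁ s₂₂ s₂₃ s₃₁ s₃₂ s₃₃ + 19
    + (s₁₁ ^ 2 * s₁₃ - s₁₁ * s₁₂ ^ 2 + s₁₁ * s₁₃ ^ 2 - s₁₂ ^ 2 * s₁₃) / 9
    + (s₁₃ ^ 3 + s₁₁ ^ 3 - 2 * s₁₂ ^ 3) / 27
    + (-2 * s₁₁ ^ 2 - 4 * s₁₁ * s₁₃ + s₁₁ * s₂₂ + 2 * s₁₂ ^ 2 + s₂₂ * s₁₂ - 2 * s₁₃ ^ 2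
        + s₂₂ * s₁₃) / 3
    - 5 * s₁₁ + 4 * s₁₃ + 3 * s₂₁ - 2 * s₂₂ - s₃₁ - s₃₂ - s₃₃

/-- The operator `E₆(e₁, …, e₉)`, with Riemann scheme
`x = 0 : 0, 1, 2, e₁, e₂, e₃`; `x = 1 : 0, 1, 2, e₄, e₅, e₆`;
`x = ∞ : s, s + 1, s + 2, e₇, e₈, e₉`. -/
def E6 (e₁ e₂ e₃ e₄ e₅ e₆ e₇ e₈ e₉ : ℂ) : Module.End ℂ K :=
  let s₁₁ := sym1 e₁ e₂ e₃
  let s₁₂ := sym1 e₄ e₅ e₆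
  let s₁₃ := sym1 e₇ e₈ e₉
  let s₂₁ := sym2 e₁ e₂ e₃
  let s₂₂ := sym2 e₄ e₅ e₆
  let s₂₃ := sym2 e₇ e₈ e₉
  let s₃₁ := sym3 e₁ e₂ e₃
  let s₃₂ := sym3 e₄ e₅ e₆
  let s₃₃ := sym3 e₇ e₈ e₉
  let s := -(s₁₁ + s₁₂ + s₁₃ - 6) / 3
  let T₁₃ : ℂ := -3
  let T₁₂ := -9 + s₁₁ - 2 * s₁₃
  let T₁₁ := coeffT11 s₁₁ s₁₂ s₁₃ s₂₁ s₂₂ s₂₃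
  let T₁₀ := coeffT10 s₁₁ s₁₂ s₁₃ s₂₁ s₂₂ s₂₃ s₃₁ s₃₂ s₃₃
  let T₂₃ : ℂ := 3
  let T₂₂ := 18 + s₁₃ - 2 * s₁₁
  let T₂₁ := coeffT21 s₁₁ s₁₂ s₁₃ s₂₁ s₂₂ s₂₃
  let T₂₀ := coeffT20 s₁₁ s₁₂ s₁₃ s₂₁ s₂₂ s₂₃ s₃₁ s₃₂ s₃₃
  let B₀ : ℂ[X] := (X + C e₇) * (X + C e₈) * (X + C e₉)
  let B₁ : ℂ[X] := C T₁₃ * X ^ 3 + C T₁₂ * X ^ 2 + C T₁₁ * X + C T₁₀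
  let B₂ : ℂ[X] := C T₂₃ * X ^ 3 + C T₂₂ * X ^ 2 + C T₂₁ * X + C T₂₀
  thetaForm
    ((X + C (s + 2)) * (X + C (s + 1)) * (X + C s) * B₀)
    ((X + C (s + 2)) * (X + C (s + 1)) * B₁)
    ((X + C (s + 2)) * B₂)
    (-((X + C (3 - e₁)) * (X + C (3 - e₂)) * (X + C (3 - e₃))))

/-- The exponents `e₁, …, e₉` of `SE₆(a, b, c, g, p, q, r)`; the entry with index `i : Fin 9` is
`e_{i+1}`. -/
def exps (a b c g p q r : ℂ) : Fin 9 → ℂ :=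
  ![p + r + 1, a + c + p + r + 2, 2 * a + 2 * c + g + p + r + 3,
    q + r + 1, b + c + q + r + 2, 2 * b + 2 * c + g + q + r + 3,
    -2 * c - (p + q + r) - 1,
    -a - b - 2 * c - (p + q + r + g) - 2,
    -2 * a - 2 * b - 2 * c - (p + q + r + g) - 3]

/-- The operator `SE₆(a, b, c, g, p, q, r)`. -/
def SE6 (a b c g p q r : ℂ) : Module.End ℂ K :=
  let e := exps a b c g p q r
  E6 (e 0) (e 1) (e 2) (e 3) (e 4) (e 5) (e 6) (e 7) (e 8)

/-- The complex number `z` is an integer. -/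
def IsInt (z : ℂ) : Prop := ∃ n : ℤ, z = n

end FuchsSE6

end

/-!
# Reducible operators in the family `SE₆`

**Factors from solutions.** `ℂ(x)[∂]` acts on every vector space over `ℂ(x)` with a connection
(`IsRep`, `Rep`). If an operator of order `n` kills a nonzero vector lying in a stable subspace of
dimension less than `n`, the operator of least order killing that vector is a proper right factor
(`isReducible_of_solution`). The spaces used here are the formal series `x ^ λ ∑ v_m x ^ m`.
Reducibility is moreover invariant under the formal adjoint and under `x ↦ 1 - x`; inside the family
`E₆` these act on the exponents by `dualExp` and `swapExp`.

**Integral exponents.** If an exponent at infinity is an integer `-N ≤ 0`, then `E₆` lowers the degree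
of polynomials of degree at most `N` and kills one of them; if `e₁ + s` is an integer `-N ≤ 0`, there
is likewise a solution `x ^ e₁ p(x)`. The positive integers are the negative ones of the adjoint
(`isReducible_of_isInt_infty`, `isReducible_of_isInt_finite`).

**Euler transforms.** Otherwise put `p = e₁ + s - 1` and `q = e₄ + s - 1`. The factors `θ + s + i` in
the `T_i` make `E₆` the Euler transform of an operator of order three: if the latter kills
`x ^ p (1 - x) ^ q f` with `f` a polynomial, then `E₆` kills the Euler transform of this function. All
such transforms lie in one plane over `ℂ(x)`, spanned by two contiguous `₂F₁` functions
(`exists_gauss_plane`), so that `E₆` is reducible (`isReducible_of_tri`). On `f`, the condition is a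
recurrence of three terms, and when `e₁ + e₄ + e₇ + s - 1 = -n` it defines an endomorphism of the
polynomials of degree at most `n`. It remains to see that its tridiagonal matrix is singular.

**Even sums.** For the exponents of `SE₆` the three second differences `e₁ - 2 e₂ + e₃`,
`e₄ - 2 e₅ + e₆`, `e₇ - 2 e₈ + e₉` are equal to `g`, and singularity holds for even `n`, for two
different reasons.
* If the three chosen exponents are extreme ones (first or last of their triple), the endomorphism is a
  multiple of `u X G + v G X + w X`, where `G` is the Jacobi operator and `X = [G, x]`. The relation
  `[G, [G, X]] = 2 (G X + X G) - (1 - κ²) X` shows that `X` maps a Jacobi polynomial into the span of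
  its two neighbours. Hence the endomorphism exchanges the even and the odd Jacobi polynomials, of
  which there are `n / 2 + 1` and `n / 2` in degrees at most `n` (`exists_ker_jac`).
* If they are the middle ones, the endomorphism is antisymmetric for the `𝔰𝔩₂`-invariant form on a
  space of odd dimension `n + 1` (`exists_ker_of_antisymm`).

Positive even sums are reduced to these by the adjoint. The integrality conditions on `a`, `b`, `c`,
`(2 a + g) / 2`, `(2 b + g) / 2`, `(2 c + g) / 2`, `a + b + c + g`, `(2 a + 2 b + 2 c + g) / 2` say that
one of the eight sums of extreme exponents is even, and the one on `(g - 1) / 2` that the sum of the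
middle exponents is.
-/

noncomputable section

namespace FuchsSE6

/-! ### Representations of the ring of differential operators -/

section Rep

variable {B : Type*} [Ring B] [Algebra ℂ B]

/-- A pair `(ρ, δ)` is a representation of `ℂ(x)[∂]` in `B` when `δ` and the functions `ρ f`
obey the commutation rule `∂ f = f ∂ + f'`. -/
def IsRep (ρ : K →ₐ[ℂ] B) (δ : B) : Prop :=
  ∀ f, δ * ρ f = ρ f * δ + ρ (derivFun f)

/-- The image of `∑_{i ≤ n} c_i ∂ ^ i` under the representation `(ρ, δ)`. -/
def repOp (ρ : K →ₐ[ℂ] B) (δ : B) (n : ℕ) (c : ℕ → K) : B :=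
  ∑ i ∈ Finset.range (n + 1), ρ (c i) * δ ^ i

/-- `b` is the image of an operator of order at most `n` whose coefficient of `∂ ^ n` is `a`. -/
def OrdLE (ρ : K →ₐ[ℂ] B) (δ : B) (b : B) (n : ℕ) (a : K) : Prop :=
  ∃ c : ℕ → K, c n = a ∧ b = repOp ρ δ n c

variable {ρ : K →ₐ[ℂ] B} {δ : B}

theorem OrdLE.add {b b' : B} {n : ℕ} {a a' : K} (h : OrdLE ρ δ b n a) (h' : OrdLE ρ δ b' n a') :
    OrdLE ρ δ (b + b') n (a + a') := by
  obtain ⟨c, rfl, rfl⟩ := h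
  obtain ⟨c', rfl, rfl⟩ := h'
  refine ⟨fun i => c i + c' i, rfl, ?_⟩
  simp only [repOp, map_add, add_mul, Finset.sum_add_distrib]

theorem OrdLE.fun_mul {b : B} {n : ℕ} {a : K} (f : K) (h : OrdLE ρ δ b n a) :
    OrdLE ρ δ (ρ f * b) n (f * a) := by
  obtain ⟨c, rfl, rfl⟩ := h
  refine ⟨fun i => f * c i, rfl, ?_⟩
  simp only [repOp, map_mul, Finset.mul_sum, mul_assoc]

theorem OrdLE.neg {b : B} {n : ℕ} {a : K} (h : OrdLE ρ δ b n a) :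
    OrdLE ρ δ (-b) n (-a) := by
  have := h.fun_mul (-1)
  simpa using this

theorem OrdLE.sub {b b' : B} {n : ℕ} {a a' : K} (h : OrdLE ρ δ b n a) (h' : OrdLE ρ δ b' n a') :
    OrdLE ρ δ (b - b') n (a - a') := by
  simpa [sub_eq_add_neg] using h.add h'.neg

theorem OrdLE.weaken {b : B} {n : ℕ} {a : K} (h : OrdLE ρ δ b n a) {m : ℕ} (hm : n < m) :
    OrdLE ρ δ b m 0 := by
  obtain ⟨c, rfl, rfl⟩ := h
  refine ⟨fun i => if i ≤ n then c i else 0, by simp [hm], ?_⟩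
  unfold repOp
  have h1 : ∑ i ∈ Finset.range (n + 1), ρ (c i) * δ ^ i =
      ∑ i ∈ Finset.range (n + 1), ρ (if i ≤ n then c i else 0) * δ ^ i := by
    refine Finset.sum_congr rfl fun i hi => ?_
    rw [if_pos (by have := Finset.mem_range.1 hi; omega)]
  rw [h1]
  refine Finset.sum_subset (fun i hi => ?_) fun i _ hi => ?_
  · have := Finset.mem_range.1 hi
    exact Finset.mem_range.2 (by omega)
  · rw [if_neg (by intro hh; exact hi (Finset.mem_range.2 (by omega)))]
    simp

theorem OrdLE.lower {b : B} {n : ℕ} (h : OrdLE ρ δ b (n + 1) 0) : ∃ a, OrdLE ρ δ b n a := by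
  obtain ⟨c, h0, rfl⟩ := h
  refine ⟨c n, c, rfl, ?_⟩
  rw [repOp, Finset.sum_range_succ, h0, map_zero, zero_mul, add_zero, repOp]

theorem OrdLE.of_fun (f : K) : OrdLE ρ δ (ρ f) 0 f :=
  ⟨fun _ => f, rfl, by simp [repOp]⟩

theorem OrdLE.deriv_mul (hδ : IsRep ρ δ) {b : B} {n : ℕ} {a : K} (h : OrdLE ρ δ b n a) :
    OrdLE ρ δ (δ * b) (n + 1) a := by
  obtain ⟨c, rfl, rfl⟩ := h
  have h1 : OrdLE ρ δ (∑ i ∈ Finset.range (n + 1), ρ (derivFun (c i)) * δ ^ i) (n + 1) 0 :=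
    OrdLE.weaken (n := n) (a := derivFun (c n)) ⟨fun i => derivFun (c i), rfl, rfl⟩ n.lt_succ_self
  have h2 : OrdLE ρ δ (∑ i ∈ Finset.range (n + 1), ρ (c i) * δ ^ (i + 1)) (n + 1) (c n) := by
    refine ⟨fun i => if i = 0 then 0 else c (i - 1), by simp, ?_⟩
    rw [repOp, Finset.sum_range_succ' _ (n + 1)]
    simp
  have h3 := h2.add h1
  rw [add_zero, ← Finset.sum_add_distrib] at h3
  convert h3 using 1
  rw [repOp, Finset.mul_sum]
  refine Finset.sum_congr rfl fun i _ => ?_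
  rw [← mul_assoc, hδ, add_mul, mul_assoc, ← pow_succ']

theorem OrdLE.deriv_pow_mul (hδ : IsRep ρ δ) {b : B} {n : ℕ} {a : K} (h : OrdLE ρ δ b n a)
    (k : ℕ) : OrdLE ρ δ (δ ^ k * b) (k + n) a := by
  induction k with
  | zero => simpa using h
  | succ k ih =>
    rw [pow_succ', mul_assoc, show k + 1 + n = k + n + 1 by ring]
    exact ih.deriv_mul hδ

theorem OrdLE.zero (n : ℕ) : OrdLE ρ δ 0 n 0 := ⟨fun _ => 0, rfl, by simp [repOp]⟩

/-- Leading coefficients multiply. -/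
theorem OrdLE.mul (hδ : IsRep ρ δ) {b b' : B} {m n : ℕ} {a a' : K} (h : OrdLE ρ δ b m a)
    (h' : OrdLE ρ δ b' n a') : OrdLE ρ δ (b * b') (m + n) (a * a') := by
  obtain ⟨c, rfl, rfl⟩ := h
  rw [repOp, Finset.sum_range_succ, add_mul, ← zero_add (c m * a')]
  refine OrdLE.add ?_ ?_
  · rw [Finset.sum_mul]
    have : ∀ k ≤ m, OrdLE ρ δ (∑ i ∈ Finset.range k, ρ (c i) * δ ^ i * b') (m + n) 0 := by
      intro k
      induction k with
      | zero => intro _; simpa using OrdLE.zero _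
      | succ k ih =>
        intro hk
        rw [Finset.sum_range_succ, ← add_zero (0 : K)]
        refine (ih (by omega)).add ?_
        rw [mul_assoc]
        exact ((h'.deriv_pow_mul hδ k).fun_mul (c k)).weaken (by omega)
    exact this m le_rfl
  · rw [mul_assoc]
    exact (h'.deriv_pow_mul hδ m).fun_mul _

theorem OrdLE.deriv (hδ : IsRep ρ δ) : OrdLE ρ δ δ 1 1 := by
  have := (OrdLE.of_fun (ρ := ρ) (δ := δ) 1).deriv_mul hδ
  simpa using this

theorem OrdLE.deriv_pow (hδ : IsRep ρ δ) (k : ℕ) : OrdLE ρ δ (δ ^ k) k 1 := by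
  have := (OrdLE.of_fun (ρ := ρ) (δ := δ) 1).deriv_pow_mul hδ k
  simpa using this

end Rep

/-- Multiplication operators, as a homomorphism of algebras. -/
def mulAlg : K →ₐ[ℂ] Module.End ℂ K := Algebra.lmul ℂ K

theorem mulAlg_apply (f : K) : mulAlg f = mulOp f := rfl

theorem isRep_D : IsRep mulAlg D := by
  intro f
  ext g
  change derivFun (f * g) = f * derivFun g + derivFun f * g
  rw [derivFun_mul, mul_comm g]

theorem hasOrder_iff {P : Module.End ℂ K} {n : ℕ} :
    HasOrder P n ↔ ∃ a, a ≠ 0 ∧ OrdLE mulAlg D P n a := by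
  constructor
  · rintro ⟨c, h, rfl⟩
    exact ⟨c n, h, c, rfl, rfl⟩
  · rintro ⟨a, ha, c, rfl, rfl⟩
    exact ⟨c, ha, rfl⟩

section Graph

variable {B : Type*} [Ring B] [Algebra ℂ B]

/-- `b` is the image of the differential operator `P` under the representation `(ρ, δ)`. -/
def Rep (ρ : K →ₐ[ℂ] B) (δ : B) (P : Module.End ℂ K) (b : B) : Prop :=
  ∃ n a, OrdLE (mulAlg.prod ρ) (D, δ) (P, b) n a

variable {ρ : K →ₐ[ℂ] B} {δ : B}

theorem isRep_prod (hδ : IsRep ρ δ) : IsRep (mulAlg.prod ρ) (D, δ) := by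
  intro f
  refine Prod.ext ?_ ?_
  · exact isRep_D f
  · exact hδ f

theorem repOp_prod (n : ℕ) (c : ℕ → K) :
    repOp (mulAlg.prod ρ) (D, δ) n c = (ofCoeffs n c, repOp ρ δ n c) := by
  refine Prod.ext ?_ ?_
  · simp [repOp, ofCoeffs, Prod.fst_sum, mulAlg_apply]
  · simp [repOp, Prod.snd_sum]

theorem rep_iff {P : Module.End ℂ K} {b : B} :
    Rep ρ δ P b ↔ ∃ n c, P = ofCoeffs n c ∧ b = repOp ρ δ n c := by
  constructor
  · rintro ⟨n, a, c, -, h⟩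
    rw [repOp_prod] at h
    exact ⟨n, c, (Prod.ext_iff.1 h).1, (Prod.ext_iff.1 h).2⟩
  · rintro ⟨n, c, rfl, rfl⟩
    exact ⟨n, c n, c, rfl, (repOp_prod n c).symm⟩

theorem Rep.mul (hδ : IsRep ρ δ) {P Q : Module.End ℂ K} {b b' : B} (h : Rep ρ δ P b)
    (h' : Rep ρ δ Q b') : Rep ρ δ (P * Q) (b * b') := by
  obtain ⟨n, a, h⟩ := h
  obtain ⟨n', a', h'⟩ := h'
  exact ⟨_, _, h.mul (isRep_prod hδ) h'⟩

theorem Rep.add {P Q : Module.End ℂ K} {b b' : B} (h : Rep ρ δ P b)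
    (h' : Rep ρ δ Q b') : Rep ρ δ (P + Q) (b + b') := by
  obtain ⟨n, a, h⟩ := h
  obtain ⟨n', a', h'⟩ := h'
  exact ⟨_, _, (h.weaken (m := n + n' + 1) (by omega)).add (h'.weaken (by omega))⟩

theorem Rep.fun (f : K) : Rep ρ δ (mulOp f) (ρ f) := ⟨0, f, OrdLE.of_fun f⟩

theorem Rep.neg {P : Module.End ℂ K} {b : B} (h : Rep ρ δ P b) : Rep ρ δ (-P) (-b) := by
  obtain ⟨n, a, h⟩ := h
  exact ⟨_, _, h.neg⟩

theorem Rep.sub {P Q : Module.End ℂ K} {b b' : B} (h : Rep ρ δ P b)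
    (h' : Rep ρ δ Q b') : Rep ρ δ (P - Q) (b - b') := by
  simpa only [sub_eq_add_neg] using h.add h'.neg

theorem Rep.deriv (hδ : IsRep ρ δ) : Rep ρ δ D δ := ⟨1, 1, OrdLE.deriv (isRep_prod hδ)⟩

theorem Rep.scalar (z : ℂ) : Rep ρ δ (algebraMap ℂ _ z) (algebraMap ℂ _ z) := by
  have h := Rep.fun (ρ := ρ) (δ := δ) (algebraMap ℂ K z)
  rwa [← mulAlg_apply, AlgHom.commutes, AlgHom.commutes] at h

theorem Rep.one : Rep ρ δ 1 1 := by simpa using Rep.scalar (ρ := ρ) (δ := δ) 1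

theorem Rep.pow (hδ : IsRep ρ δ) {P : Module.End ℂ K} {b : B} (h : Rep ρ δ P b) (k : ℕ) :
    Rep ρ δ (P ^ k) (b ^ k) := by
  induction k with
  | zero => simpa using Rep.one
  | succ k ih => rw [pow_succ, pow_succ]; exact ih.mul hδ h

theorem Rep.aeval (hδ : IsRep ρ δ) {P : Module.End ℂ K} {b : B} (h : Rep ρ δ P b) (T : ℂ[X]) :
    Rep ρ δ (aeval P T) (aeval b T) := by
  induction T using Polynomial.induction_on' with
  | add p q hp hq => rw [map_add, map_add]; exact hp.add hq
  | monomial n a =>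
    rw [aeval_monomial, aeval_monomial]
    exact (Rep.scalar a).mul hδ (h.pow hδ n)

theorem Rep.theta (hδ : IsRep ρ δ) : Rep ρ δ theta (ρ RatFunc.X * δ) :=
  (Rep.fun _).mul hδ (Rep.deriv hδ)

/-- The image of an operator does not depend on its presentation. -/
theorem Rep.unique {P : Module.End ℂ K} {b b' : B} (h : Rep ρ δ P b) (h' : Rep ρ δ P b') :
    b = b' := by
  obtain ⟨n, c, h1, h2⟩ := rep_iff.1 (h.sub h')
  rw [sub_self] at h1
  have h3 := coeff_eq_zero h1.symm
  refine sub_eq_zero.1 (h2.trans ?_)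
  refine Finset.sum_eq_zero fun i hi => ?_
  rw [h3 i (by have := Finset.mem_range.1 hi; omega), map_zero, zero_mul]

theorem HasOrder.exists_rep {P : Module.End ℂ K} {n : ℕ} (h : HasOrder P n) :
    ∃ b, Rep ρ δ P b := by
  obtain ⟨c, -, h⟩ := h
  exact ⟨_, rep_iff.2 ⟨n, c, h, rfl⟩⟩

/-- The image of an operator written in terms of `θ` and `∂`. -/
theorem Rep.thetaForm (hδ : IsRep ρ δ) (T₀ T₁ T₂ T₃ : ℂ[X]) :
    Rep ρ δ (thetaForm T₀ T₁ T₂ T₃)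
      (Polynomial.aeval (ρ RatFunc.X * δ) T₀ + Polynomial.aeval (ρ RatFunc.X * δ) T₁ * δ
        + Polynomial.aeval (ρ RatFunc.X * δ) T₂ * δ ^ 2
        + Polynomial.aeval (ρ RatFunc.X * δ) T₃ * δ ^ 3) := by
  have ht := Rep.theta hδ
  have hd := Rep.deriv hδ
  exact (((ht.aeval hδ T₀).add ((ht.aeval hδ T₁).mul hδ hd)).add
    ((ht.aeval hδ T₂).mul hδ (hd.pow hδ 2))).add ((ht.aeval hδ T₃).mul hδ (hd.pow hδ 3))

end Graph

/-! ### Solutions in small differential modules force a factorisation -/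

/-- Euclidean division on the right by an operator of order `j`. -/
theorem exists_div {G : Module.End ℂ K} {j : ℕ} {b : K} (hb : b ≠ 0) (hG : OrdLE mulAlg D G j b) :
    ∀ (m : ℕ) (P : Module.End ℂ K) (a : K), OrdLE mulAlg D P (m + j) a →
      ∃ F, OrdLE mulAlg D F m (a / b) ∧
        ∃ c : ℕ → K, P - F * G = ∑ i ∈ Finset.range j, mulOp (c i) * D ^ i := by
  intro m
  induction m with
  | zero =>
    intro P a hP
    have h1 := hP.sub (((OrdLE.deriv_pow isRep_D 0).fun_mul (a / b)).mul isRep_D hG)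
    rw [zero_add, mul_one, div_mul_cancel₀ _ hb, sub_self] at h1
    refine ⟨_, OrdLE.of_fun (a / b), ?_⟩
    obtain ⟨c, h0, h2⟩ := h1
    refine ⟨c, ?_⟩
    rw [pow_zero, mul_one] at h2
    rw [h2, repOp, Finset.sum_range_succ, h0, map_zero, zero_mul, add_zero]
    rfl
  | succ m ih =>
    intro P a hP
    have h1 := hP.sub (((OrdLE.deriv_pow isRep_D (m + 1)).fun_mul (a / b)).mul isRep_D hG)
    rw [mul_one, div_mul_cancel₀ _ hb, sub_self, show m + 1 + j = m + j + 1 by ring] at h1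
    obtain ⟨a', h2⟩ := h1.lower
    obtain ⟨F, hF, c, hc⟩ := ih _ _ h2
    refine ⟨mulAlg (a / b) * D ^ (m + 1) + F, ?_, c, ?_⟩
    · have h3 := ((OrdLE.deriv_pow isRep_D (m + 1)).fun_mul (a / b)).add
        (hF.weaken m.lt_succ_self)
      simpa using h3
    · rw [← hc]
      noncomm_ring

section Module

variable {M : Type*} [AddCommGroup M] [Module ℂ M] [Module K M] [IsScalarTower ℂ K M]

/-- Multiplication by rational functions on a vector space over `ℂ(x)`. -/
def smulAlg (M : Type*) [AddCommGroup M] [Module ℂ M] [Module K M] [IsScalarTower ℂ K M] :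
    K →ₐ[ℂ] Module.End ℂ M := Algebra.lsmul ℂ ℂ M

theorem smulAlg_apply (f : K) (v : M) : smulAlg M f v = f • v := rfl

theorem repOp_apply (δ : Module.End ℂ M) (n : ℕ) (c : ℕ → K) (v : M) :
    repOp (smulAlg M) δ n c v = ∑ i ∈ Finset.range (n + 1), c i • (δ ^ i) v := by
  simp [repOp, LinearMap.sum_apply, Module.End.mul_apply, smulAlg_apply]

/-- If an operator of order `n` has a nonzero solution inside a stable subspace of dimension
less than `n` of some differential module over `ℂ(x)`, then it is reducible: the operator
of least order killing the solution is a right factor. -/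
theorem isReducible_of_solution {δ : Module.End ℂ M} (hδ : IsRep (smulAlg M) δ)
    {E : Module.End ℂ K} {E' : Module.End ℂ M} {n : ℕ} {a : K} (ha : a ≠ 0)
    (hE : OrdLE mulAlg D E n a) (hEE' : Rep (smulAlg M) δ E E') {v : M} (hv : v ≠ 0)
    (hEv : E' v = 0) (N : Submodule K M) [Module.Finite K N] (hN : Module.finrank K N < n)
    (hvN : v ∈ N) (hstab : ∀ w ∈ N, δ w ∈ N) : IsReducible E := by
  classical
  have hpow : ∀ i : ℕ, (δ ^ i) v ∈ N := by
    intro i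
    induction i with
    | zero => simpa using hvN
    | succ i ih => rw [pow_succ', Module.End.mul_apply]; exact hstab _ ih
  let p : ℕ → Prop := fun j => ∃ c : ℕ → K, c j ≠ 0 ∧ repOp (smulAlg M) δ j c v = 0
  have hp : ∃ j, j < n ∧ p j := by
    by_contra hcon
    push Not at hcon
    have hli : LinearIndependent K
        (fun i : Fin (Module.finrank K N + 1) => (⟨(δ ^ (i : ℕ)) v, hpow i⟩ : N)) := by
      rw [Fintype.linearIndependent_iff]
      intro g hg
      by_contra hne
      push Not at hne
      set s : Finset (Fin (Module.finrank K N + 1)) := {i | g i ≠ 0}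
      have hs : s.Nonempty := by
        obtain ⟨i, hi⟩ := hne
        exact ⟨i, by simp [s, hi]⟩
      let j := s.max' hs
      have hj : g j ≠ 0 := by
        have := s.max'_mem hs
        simpa [s] using this
      let c : ℕ → K := fun i => if h : i < Module.finrank K N + 1 then g ⟨i, h⟩ else 0
      have hc : ∀ i : Fin (Module.finrank K N + 1), c i = g i := fun i => dif_pos i.2
      refine hcon j (by have := j.2; omega) ⟨c, by rw [hc]; exact hj, ?_⟩
      rw [repOp_apply]
      have h1 := congrArg (Subtype.val) hg
      rw [AddSubmonoidClass.coe_finsetSum] at h1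
      have h2 : ∑ i ∈ Finset.range (Module.finrank K N + 1), c i • (δ ^ i) v = 0 := by
        rw [Finset.sum_range]
        refine Eq.trans (Finset.sum_congr rfl fun i _ => ?_) h1
        rw [hc]; rfl
      rw [← h2]
      refine Finset.sum_subset (fun i hi => ?_) fun i hi hi' => ?_
      · have := Finset.mem_range.1 hi
        have := j.2
        exact Finset.mem_range.2 (by omega)
      · have hi1 := Finset.mem_range.1 hi
        have hi2 : ¬ i < (j : ℕ) + 1 := fun h => hi' (Finset.mem_range.2 h)
        have : g ⟨i, hi1⟩ = 0 := by
          by_contra hgi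
          have h3 : (⟨i, hi1⟩ : Fin _) ≤ j := s.le_max' _ (by simp [s, hgi])
          have h4 : i ≤ (j : ℕ) := h3
          omega
        have h5 : c i = 0 := by rw [← this]; exact hc ⟨i, hi1⟩
        rw [h5, zero_smul]
    have := hli.fintype_card_le_finrank
    simp at this
  have hex : ∃ j, p j := let ⟨j, _, h⟩ := hp; ⟨j, h⟩
  set j := Nat.find hex with hjdef
  obtain ⟨c, hcj, hcv⟩ := Nat.find_spec hex
  rw [← hjdef] at hcj hcv
  have hjn : j < n := by
    obtain ⟨i, hi, h⟩ := hp
    exact lt_of_le_of_lt (Nat.find_min' hex h) hi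
  have hj0 : 0 < j := by
    rcases Nat.eq_zero_or_pos j with h0 | h0
    · rw [h0] at hcj hcv
      rw [repOp_apply] at hcv
      simp only [zero_add, Finset.range_one, Finset.sum_singleton, pow_zero,
        Module.End.one_apply] at hcv
      exact absurd hcv (smul_ne_zero hcj hv)
    · exact h0
  have hG : OrdLE mulAlg D (ofCoeffs j c) j (c j) := ⟨c, rfl, rfl⟩
  have hE2 : OrdLE mulAlg D E (n - j + j) a := by rwa [Nat.sub_add_cancel hjn.le]
  obtain ⟨F, hF, d, hd⟩ := exists_div hcj hG (n - j) E a hE2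
  -- the remainder kills the solution, so it vanishes by minimality of the order
  have hd0 : ∀ k ≤ j, ∀ i < k, d (j - 1 - i) = 0 := by
    obtain ⟨F', hF'⟩ := HasOrder.exists_rep (ρ := smulAlg M) (δ := δ)
      (hasOrder_iff.2 ⟨_, div_ne_zero ha hcj, hF⟩)
    have hG' : Rep (smulAlg M) δ (ofCoeffs j c) (repOp (smulAlg M) δ j c) :=
      rep_iff.2 ⟨j, c, rfl, rfl⟩
    have hrem := hEE'.sub (hF'.mul hδ hG')
    have hrem2 : Rep (smulAlg M) δ (∑ i ∈ Finset.range j, mulOp (d i) * D ^ i)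
        (repOp (smulAlg M) δ (j - 1) d) := by
      refine rep_iff.2 ⟨j - 1, d, ?_, rfl⟩
      rw [ofCoeffs, Nat.sub_add_cancel hj0]
    rw [hd] at hrem
    have hzero : repOp (smulAlg M) δ (j - 1) d v = 0 := by
      rw [hrem2.unique hrem, LinearMap.sub_apply, Module.End.mul_apply, hEv, hcv, map_zero,
        sub_zero]
    intro k
    induction k with
    | zero => intro _ i hi; omega
    | succ k ih =>
      intro hk i hi
      rcases Nat.lt_succ_iff_lt_or_eq.1 hi with h | rfl
      · exact ih (by omega) i h
      · by_contra hne
        refine Nat.find_min hex (m := j - 1 - i) (by omega) ⟨d, hne, ?_⟩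
        rw [repOp_apply] at hzero ⊢
        rw [← hzero]
        refine Finset.sum_subset (fun l hl => ?_) fun l hl hl' => ?_
        · have := Finset.mem_range.1 hl
          exact Finset.mem_range.2 (by omega)
        · have h1 := Finset.mem_range.1 hl
          have h2 : ¬ l < j - 1 - i + 1 := fun h => hl' (Finset.mem_range.2 h)
          have h3 := ih (by omega) (j - 1 - l) (by omega)
          rw [show j - 1 - (j - 1 - l) = l by omega] at h3
          rw [h3, zero_smul]
  have hR : E - F * ofCoeffs j c = 0 := by
    rw [hd]
    refine Finset.sum_eq_zero fun i hi => ?_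
    have h1 := Finset.mem_range.1 hi
    have h3 := hd0 j le_rfl (j - 1 - i) (by omega)
    rw [show j - 1 - (j - 1 - i) = i by omega] at h3
    rw [h3, ← mulAlg_apply, map_zero, zero_mul]
  exact ⟨F, ofCoeffs j c, n - j, j, by omega, hj0,
    hasOrder_iff.2 ⟨_, div_ne_zero ha hcj, hF⟩, ⟨c, hcj, rfl⟩, sub_eq_zero.1 hR⟩

end Module

/-! ### Symmetries preserving reducibility -/

open MulOpposite in
/-- Multiplication operators, as a homomorphism into the opposite algebra. -/
def mulOpAlg : K →ₐ[ℂ] (Module.End ℂ K)ᵐᵒᵖ :=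
  mulAlg.toOpposite fun f g => by
    rw [commute_iff_eq, ← map_mul, ← map_mul, mul_comm]

open MulOpposite in
theorem mulOpAlg_apply (f : K) : mulOpAlg f = op (mulOp f) := rfl

open MulOpposite in
/-- The formal adjoint, `f ↦ f` and `∂ ↦ -∂`, is a representation in the opposite ring. -/
theorem isRep_adjoint : IsRep mulOpAlg (op (-D)) := by
  intro f
  rw [mulOpAlg_apply, mulOpAlg_apply, ← op_mul, ← op_mul, ← op_add]
  congr 1
  have h := isRep_D f
  rw [mulAlg_apply, mulAlg_apply] at h
  rw [neg_mul, h]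
  noncomm_ring

open MulOpposite in
/-- `Q` is the formal adjoint of `P`. -/
def IsAdjoint (P Q : Module.End ℂ K) : Prop := Rep mulOpAlg (op (-D)) P (op Q)

open MulOpposite in
theorem IsAdjoint.mul {P Q P' Q' : Module.End ℂ K} (h : IsAdjoint P P') (h' : IsAdjoint Q Q') :
    IsAdjoint (P * Q) (Q' * P') :=
  Rep.mul isRep_adjoint h h'

open MulOpposite in
/-- Every differential operator has a formal adjoint, of the same order; the adjoint of the adjoint
is the operator itself. -/
theorem OrdLE.isAdjoint {P : Module.End ℂ K} {n : ℕ} {a : K} (h : OrdLE mulAlg D P n a) :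
    ∃ Q, IsAdjoint P Q ∧ IsAdjoint Q P ∧ OrdLE mulAlg D Q n ((-1) ^ n * a) := by
  obtain ⟨c, rfl, rfl⟩ := h
  have hfun : ∀ f : K, IsAdjoint (mulAlg f) (mulAlg f) := fun f => Rep.fun f
  have hD : IsAdjoint (-D) D := by
    have h := (Rep.deriv isRep_adjoint).neg
    rwa [← op_neg, neg_neg] at h
  have hD' : IsAdjoint D (-D) := Rep.deriv isRep_adjoint
  have hpow : ∀ i : ℕ, IsAdjoint ((-D) ^ i) (D ^ i) := fun i => hD.pow isRep_adjoint i
  have hpow' : ∀ i : ℕ, IsAdjoint (D ^ i) ((-D) ^ i) := fun i => hD'.pow isRep_adjoint i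
  have hterm : ∀ i (f : K), OrdLE mulAlg D ((-D) ^ i * mulAlg f) i ((-1) ^ i * f) := by
    intro i f
    have h1 := ((OrdLE.of_fun (ρ := mulAlg) (δ := D) f).deriv_pow_mul isRep_D i).fun_mul
      ((-1) ^ i)
    have h2 : (-D) ^ i * mulAlg f = mulAlg ((-1) ^ i) * (D ^ i * mulAlg f) := by
      rw [neg_pow, map_pow, map_neg, map_one, mul_assoc]
    rw [h2]
    simpa using h1
  refine ⟨∑ i ∈ Finset.range (n + 1), (-D) ^ i * mulAlg (c i), ?_, ?_, ?_⟩
  · unfold repOp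
    generalize n + 1 = N
    induction N with
    | zero =>
      have h := hfun 0
      simpa using h
    | succ N ih =>
      rw [Finset.sum_range_succ, Finset.sum_range_succ]
      exact Rep.add ih ((hfun _).mul (hpow' _))
  · unfold repOp
    generalize n + 1 = N
    induction N with
    | zero =>
      have h := hfun 0
      simpa using h
    | succ N ih =>
      rw [Finset.sum_range_succ, Finset.sum_range_succ]
      exact Rep.add ih ((hpow _).mul (hfun _))
  · rw [Finset.sum_range_succ, ← zero_add ((-1) ^ n * c n)]
    refine OrdLE.add ?_ (hterm n _)
    have : ∀ k ≤ n, OrdLE mulAlg D (∑ i ∈ Finset.range k, (-D) ^ i * mulAlg (c i)) n 0 := by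
      intro k
      induction k with
      | zero => intro _; simpa using OrdLE.zero _
      | succ k ih =>
        intro hk
        rw [Finset.sum_range_succ, ← add_zero (0 : K)]
        exact (ih (by omega)).add ((hterm k _).weaken (by omega))
    exact this n le_rfl

/-- An operator is reducible as soon as its formal adjoint is. -/
theorem IsAdjoint.isReducible {P Q : Module.End ℂ K} (h : IsAdjoint Q P) (hQ : IsReducible Q) :
    IsReducible P := by
  obtain ⟨F, G, m, n, hm, hn, hF, hG, rfl⟩ := hQ
  obtain ⟨a, ha, hF⟩ := hasOrder_iff.1 hF
  obtain ⟨b, hb, hG⟩ := hasOrder_iff.1 hG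
  obtain ⟨F', hF1, -, hF2⟩ := hF.isAdjoint
  obtain ⟨G', hG1, -, hG2⟩ := hG.isAdjoint
  have h1 := Rep.unique h (hF1.mul hG1)
  have hu : ∀ (k : ℕ) (z : K), z ≠ 0 → (-1) ^ k * z ≠ 0 := fun k z hz =>
    mul_ne_zero (pow_ne_zero _ (neg_ne_zero.2 one_ne_zero)) hz
  exact ⟨G', F', n, m, hn, hm, hasOrder_iff.2 ⟨_, hu _ _ hb, hG2⟩,
    hasOrder_iff.2 ⟨_, hu _ _ ha, hF2⟩, MulOpposite.op_injective h1⟩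

/-- The automorphism `x ↦ 1 - x` of `ℂ[x]`. -/
def reflPoly : ℂ[X] ≃ₐ[ℂ] ℂ[X] :=
  AlgEquiv.ofAlgHom (aeval (1 - X)) (aeval (1 - X)) (by ext; simp) (by ext; simp)

/-- The automorphism `x ↦ 1 - x` of `ℂ(x)`. -/
def refl : K ≃ₐ[ℂ] K := IsFractionRing.fieldEquivOfAlgEquiv ℂ K K reflPoly

theorem refl_algebraMap (u : ℂ[X]) :
    refl (algebraMap ℂ[X] K u) = algebraMap ℂ[X] K (u.comp (1 - X)) := by
  have h : reflPoly u = u.comp (1 - X) := by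
    change aeval (1 - X) u = _
    rw [aeval_def, comp]
    rfl
  rw [← h]
  exact IsFractionRing.fieldEquivOfAlgEquiv_algebraMap ..

theorem derivFun_refl (f : K) : derivFun (refl f) = -refl (derivFun f) := by
  obtain ⟨u, v, hv, rfl⟩ := exists_frac f
  have hv' : v.comp (1 - X) ≠ 0 := by
    intro h
    apply hv
    have h1 : refl (algebraMap ℂ[X] K v) = 0 := by rw [refl_algebraMap, h, map_zero]
    rw [EmbeddingLike.map_eq_zero_iff] at h1
    exact RatFunc.algebraMap_injective ℂ (h1.trans (map_zero _).symm)
  rw [map_div₀, refl_algebraMap, refl_algebraMap, derivFun_div _ _ hv', derivFun_div _ _ hv]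
  simp only [map_div₀, map_sub, map_mul, map_pow, refl_algebraMap, derivative_comp]
  simp
  ring

/-- Conjugation by `x ↦ 1 - x`, on functions. -/
def reflAlg : K →ₐ[ℂ] Module.End ℂ K := mulAlg.comp refl.toAlgHom

theorem isRep_refl : IsRep reflAlg (-D) := by
  intro f
  have h := isRep_D (refl f)
  rw [derivFun_refl] at h
  change -D * mulAlg (refl f) = mulAlg (refl f) * -D + mulAlg (refl (derivFun f))
  rw [neg_mul, h, map_neg]
  noncomm_ring

theorem OrdLE.refl {P : Module.End ℂ K} {n : ℕ} {a : K} (h : OrdLE mulAlg D P n a) :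
    ∃ Q, Rep reflAlg (-D) P Q ∧ OrdLE mulAlg D Q n ((-1) ^ n * refl a) := by
  obtain ⟨c, rfl, rfl⟩ := h
  refine ⟨repOp reflAlg (-D) n c, rep_iff.2 ⟨n, c, rfl, rfl⟩,
    fun i => (-1) ^ i * FuchsSE6.refl (c i), rfl, ?_⟩
  refine Finset.sum_congr rfl fun i _ => ?_
  change mulAlg (FuchsSE6.refl (c i)) * (-D) ^ i = _
  change _ = mulAlg ((-1) ^ i * FuchsSE6.refl (c i)) * D ^ i
  rw [neg_pow, mul_comm ((-1 : K) ^ i), map_mul, map_pow, map_neg, map_one, mul_assoc]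

/-- Reducibility is invariant under the change of variable `x ↦ 1 - x`. -/
theorem isReducible_of_refl {P Q : Module.End ℂ K} (h : Rep reflAlg (-D) Q P)
    (hQ : IsReducible Q) : IsReducible P := by
  obtain ⟨F, G, m, n, hm, hn, hF, hG, rfl⟩ := hQ
  obtain ⟨a, ha, hF⟩ := hasOrder_iff.1 hF
  obtain ⟨b, hb, hG⟩ := hasOrder_iff.1 hG
  obtain ⟨F', hF1, hF2⟩ := hF.refl
  obtain ⟨G', hG1, hG2⟩ := hG.refl
  have h1 := Rep.unique h (hF1.mul isRep_refl hG1)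
  have hu : ∀ (k : ℕ) (z : K), z ≠ 0 → (-1) ^ k * refl z ≠ 0 := fun k z hz =>
    mul_ne_zero (pow_ne_zero _ (neg_ne_zero.2 one_ne_zero)) (by simpa using hz)
  exact ⟨F', G', m, n, hm, hn, hasOrder_iff.2 ⟨_, hu _ _ ha, hF2⟩,
    hasOrder_iff.2 ⟨_, hu _ _ hb, hG2⟩, h1⟩

/-! ### The operator `E₆` in terms of powers of `∂` -/

section Desc

variable {B : Type*} [Ring B] [Algebra ℂ B] {ρ : K →ₐ[ℂ] B} {δ : B}

theorem derivFun_X : derivFun RatFunc.X = 1 := by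
  rw [← RatFunc.algebraMap_X, derivFun_algebraMap]
  simp

theorem deriv_pow_mul_X (hδ : IsRep ρ δ) (k : ℕ) :
    δ ^ k * ρ RatFunc.X = ρ RatFunc.X * δ ^ k + k * δ ^ (k - 1) := by
  induction k with
  | zero => simp
  | succ k ih =>
    have h := hδ RatFunc.X
    rw [derivFun_X, map_one] at h
    rw [pow_succ, mul_assoc, h, mul_add, mul_one, ← mul_assoc, ih, add_mul, mul_assoc,
      ← pow_succ]
    rcases k with _ | k
    · simp
    · simp only [Nat.add_sub_cancel, mul_assoc, ← pow_succ]
      push_cast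
      noncomm_ring

/-- `θ (θ - 1) ⋯ (θ - k + 1) = x ^ k ∂ ^ k`. -/
theorem aeval_descPochhammer (hδ : IsRep ρ δ) (k : ℕ) :
    aeval (ρ RatFunc.X * δ) (descPochhammer ℂ k) = ρ (RatFunc.X ^ k) * δ ^ k := by
  induction k with
  | zero => simp
  | succ k ih =>
    rw [descPochhammer_succ_right, map_mul, ih, map_sub, aeval_X, map_natCast, mul_sub,
      mul_assoc, ← mul_assoc (δ ^ k), deriv_pow_mul_X hδ, add_mul, mul_add]
    rcases k with _ | k
    · simp
    · rw [Nat.add_sub_cancel, mul_assoc _ (δ ^ k), ← pow_succ, mul_assoc _ _ δ, ← pow_succ,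
        ← mul_assoc, ← map_mul, ← pow_succ, (Nat.cast_commute (k + 1) (δ ^ (k + 1))).eq,
        mul_assoc (ρ (RatFunc.X ^ (k + 1)))]
      noncomm_ring

end Desc

/-- The coefficient of `∂ ^ j` in `∑_{i, k} n_{ik} x ^ k ∂ ^ (k + i)`, `i ≤ 3`. -/
def diffCoeff (n : ℕ → ℕ → ℂ) (j : ℕ) : ℂ[X] :=
  ∑ i ∈ Finset.range 4, if i ≤ j then C (n i (j - i)) * X ^ (j - i) else 0

/-- The polynomial with coefficients `n` in the basis of falling factorials. -/
def newtonPoly (N : ℕ) (n : ℕ → ℂ) : ℂ[X] :=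
  ∑ k ∈ Finset.range N, C (n k) * descPochhammer ℂ k

/-- With the `T_i` expanded in falling factorials, `θ (θ - 1) ⋯ (θ - k + 1) = x ^ k ∂ ^ k` turns the
`θ`-form into the form `∑ c_j ∂ ^ j`. -/
theorem thetaForm_newton (n : ℕ → ℕ → ℂ) :
    thetaForm (newtonPoly 7 (n 0)) (newtonPoly 6 (n 1)) (newtonPoly 5 (n 2)) (newtonPoly 4 (n 3)) =
      ofCoeffs 6 fun j => algebraMap ℂ[X] K (diffCoeff n j) := by
  have h1 : ∀ N i, aeval theta (newtonPoly N (n i)) * D ^ i =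
      ∑ k ∈ Finset.range N, mulAlg (algebraMap ℂ[X] K (C (n i k) * X ^ k)) * D ^ (k + i) := by
    intro N i
    rw [newtonPoly, map_sum, Finset.sum_mul]
    refine Finset.sum_congr rfl fun k _ => ?_
    have h2 : aeval theta (descPochhammer ℂ k) = mulAlg (RatFunc.X ^ k) * D ^ k :=
      aeval_descPochhammer isRep_D k
    have h3 : aeval theta (C (n i k)) = mulAlg (algebraMap ℂ K (n i k)) := by
      rw [aeval_C, AlgHom.commutes]
    rw [map_mul, h2, h3, map_mul (algebraMap ℂ[X] K), map_pow (algebraMap ℂ[X] K),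
      RatFunc.algebraMap_X, map_mul mulAlg, pow_add]
    rw [mul_assoc, mul_assoc, mul_assoc]
    rfl
  have h0 := h1 7 0
  have h1' := h1 6 1
  rw [pow_zero, mul_one] at h0
  rw [pow_one] at h1'
  unfold thetaForm
  rw [h0, h1', h1 5 2, h1 4 3]
  simp only [ofCoeffs, diffCoeff, Finset.sum_range_succ, Finset.sum_range_zero, ← mulAlg_apply]
  norm_num [add_mul]
  abel

/-- Newton coefficients of `c₀ + c₁ t + c₂ t² + c₃ t³`. -/
def newtonCubic (c₀ c₁ c₂ c₃ : ℂ) : ℕ → ℂ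
  | 0 => c₀
  | 1 => c₁ + c₂ + c₃
  | 2 => c₂ + 3 * c₃
  | 3 => c₃
  | _ => 0

/-- Effect on Newton coefficients of the multiplication by `t + σ`. -/
def newtonMul (σ : ℂ) (n : ℕ → ℂ) : ℕ → ℂ
  | 0 => σ * n 0
  | k + 1 => n k + (k + 1 + σ) * n (k + 1)

theorem newtonPoly_cubic (c₀ c₁ c₂ c₃ : ℂ) :
    newtonPoly 4 (newtonCubic c₀ c₁ c₂ c₃) = C c₃ * X ^ 3 + C c₂ * X ^ 2 + C c₁ * X + C c₀ := by
  refine Polynomial.funext fun t => ?_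
  simp [newtonPoly, Finset.sum_range_succ, newtonCubic, descPochhammer_succ_right]
  ring

theorem newtonPoly_mul (σ : ℂ) (N : ℕ) (n : ℕ → ℂ) (hn : n N = 0) :
    newtonPoly (N + 1) (newtonMul σ n) = (X + C σ) * newtonPoly N n := by
  have key : ∀ M : ℕ, newtonPoly (M + 1) (newtonMul σ n) =
      (X + C σ) * newtonPoly M n + C ((M + σ) * n M) * descPochhammer ℂ M := by
    intro M
    induction M with
    | zero => simp [newtonPoly, newtonMul]
    | succ M ih =>
      rw [newtonPoly, Finset.sum_range_succ, ← newtonPoly, ih, newtonPoly, newtonPoly,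
        Finset.sum_range_succ, newtonMul, descPochhammer_succ_right]
      simp only [map_add, map_mul, map_one, map_natCast, Nat.cast_add, Nat.cast_one]
      ring
  rw [key, hn]
  simp

/-- The Newton coefficients of `T₀, …, T₃`, as functions of `s` and the `s_{ij}`. -/
def e6Newton (s s₁₁ s₁₂ s₁₃ s₂₁ s₂₂ s₂₃ s₃₁ s₃₂ s₃₃ : ℂ) : ℕ → ℕ → ℂ
  | 0 => newtonMul (s + 2) (newtonMul (s + 1) (newtonMul s (newtonCubic s₃₃ s₂₃ s₁₃ 1)))
  | 1 => newtonMul (s + 2) (newtonMul (s + 1) (newtonCubic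
      (coeffT10 s₁₁ s₁₂ s₁₃ s₂₁ s₂₂ s₂₃ s₃₁ s₃₂ s₃₃) (coeffT11 s₁₁ s₁₂ s₁₃ s₂₁ s₂₂ s₂₃)
      (-9 + s₁₁ - 2 * s₁₃) (-3)))
  | 2 => newtonMul (s + 2) (newtonCubic
      (coeffT20 s₁₁ s₁₂ s₁₃ s₂₁ s₂₂ s₂₃ s₃₁ s₃₂ s₃₃) (coeffT21 s₁₁ s₁₂ s₁₃ s₂₁ s₂₂ s₂₃)
      (18 + s₁₃ - 2 * s₁₁) 3)
  | _ => newtonCubic (s₃₁ - 3 * s₂₁ + 9 * s₁₁ - 27) (-s₂₁ + 6 * s₁₁ - 27) (s₁₁ - 9) (-1)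

/-- The parameter `s`, an exponent at infinity, given by the Fuchs relation. -/
def sOf (e : Fin 9 → ℂ) : ℂ :=
  -(sym1 (e 0) (e 1) (e 2) + sym1 (e 3) (e 4) (e 5) + sym1 (e 6) (e 7) (e 8) - 6) / 3

/-- The coefficients of `E₆(e)` with respect to the powers of `∂`. -/
def e6Coeff (e : Fin 9 → ℂ) (j : ℕ) : ℂ[X] :=
  diffCoeff (e6Newton (sOf e)
    (sym1 (e 0) (e 1) (e 2)) (sym1 (e 3) (e 4) (e 5)) (sym1 (e 6) (e 7) (e 8))
    (sym2 (e 0) (e 1) (e 2)) (sym2 (e 3) (e 4) (e 5)) (sym2 (e 6) (e 7) (e 8))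
    (sym3 (e 0) (e 1) (e 2)) (sym3 (e 3) (e 4) (e 5)) (sym3 (e 6) (e 7) (e 8))) j

/-- `E₆` as a function of the vector of its exponents. -/
def E6v (e : Fin 9 → ℂ) : Module.End ℂ K :=
  E6 (e 0) (e 1) (e 2) (e 3) (e 4) (e 5) (e 6) (e 7) (e 8)

theorem E6v_eq (e : Fin 9 → ℂ) :
    E6v e = ofCoeffs 6 fun j => algebraMap ℂ[X] K (e6Coeff e j) := by
  unfold e6Coeff
  rw [← thetaForm_newton, E6v, E6]
  rw [show -(sym1 (e 0) (e 1) (e 2) + sym1 (e 3) (e 4) (e 5) + sym1 (e 6) (e 7) (e 8) - 6) / 3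
    = sOf e from rfl]
  congr 1
  · rw [e6Newton, newtonPoly_mul, newtonPoly_mul, newtonPoly_mul, newtonPoly_cubic]
    · simp only [sym1, sym2, sym3, map_add, map_mul, map_one]
      ring
    all_goals simp [newtonMul, newtonCubic]
  · rw [e6Newton, newtonPoly_mul, newtonPoly_mul, newtonPoly_cubic]
    · ring
    all_goals simp [newtonMul, newtonCubic]
  · rw [e6Newton, newtonPoly_mul, newtonPoly_cubic]
    simp [newtonCubic]
  · rw [e6Newton, newtonPoly_cubic]
    · simp only [sym1, sym2, sym3, map_add, map_mul, map_sub, map_neg, map_one, map_ofNat]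
      ring
    all_goals simp

theorem e6Coeff_six (e : Fin 9 → ℂ) : e6Coeff e 6 = X ^ 3 * (X - 1) ^ 3 := by
  simp [e6Coeff, diffCoeff, Finset.sum_range_succ, e6Newton, newtonMul, newtonCubic, map_ofNat]
  ring

/-- `E₆` has order six, with leading coefficient `x ^ 3 (x - 1) ^ 3`. -/
theorem E6v_ordLE (e : Fin 9 → ℂ) :
    ∃ a : K, a ≠ 0 ∧ OrdLE mulAlg D (E6v e) 6 a := by
  refine ⟨algebraMap ℂ[X] K (e6Coeff e 6), RatFunc.algebraMap_ne_zero ?_, _, rfl, E6v_eq e⟩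
  rw [e6Coeff_six]
  exact mul_ne_zero (pow_ne_zero _ X_ne_zero) (pow_ne_zero _ (X_sub_C_ne_zero 1))

/-! ### Symmetries of the family `E₆` -/

/-- The coefficients of `E₆` under `x ↦ 1 - x`; the hypothesis `h` is the Fuchs relation. -/
theorem diffCoeff_refl (s s₁₁ s₁₂ s₁₃ s₂₁ s₂₂ s₂₃ s₃₁ s₃₂ s₃₃ : ℂ)
    (h : s₁₂ = 6 - 3 * s - s₁₁ - s₁₃) {j : ℕ} (hj : j ≤ 6) :
    (-1) ^ j * (diffCoeff (e6Newton s s₁₁ s₁₂ s₁₃ s₂₁ s₂₂ s₂₃ s₃₁ s₃₂ s₃₃) j).comp (1 - X) =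
      diffCoeff (e6Newton s s₁₂ s₁₁ s₁₃ s₂₂ s₂₁ s₂₃ s₃₂ s₃₁ s₃₃) j := by
  subst h
  refine Polynomial.funext fun t => ?_
  interval_cases j <;>
    simp [diffCoeff, Finset.sum_range_succ, e6Newton, newtonMul, newtonCubic, coeffT10, coeffT11,
      coeffT20, coeffT21] <;>
    ring

/-- Exchange of the exponents at `0` and at `1`. -/
def swapExp (e : Fin 9 → ℂ) : Fin 9 → ℂ :=
  ![e 3, e 4, e 5, e 0, e 1, e 2, e 6, e 7, e 8]

theorem swapExp_swapExp (e : Fin 9 → ℂ) : swapExp (swapExp e) = e := by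
  funext i; fin_cases i <;> rfl

theorem sOf_swapExp (e : Fin 9 → ℂ) : sOf (swapExp e) = sOf e := by
  change -(sym1 (e 3) (e 4) (e 5) + sym1 (e 0) (e 1) (e 2) + sym1 (e 6) (e 7) (e 8) - 6) / 3 = _
  rw [sOf]
  ring

/-- The substitution `x ↦ 1 - x` exchanges the exponents at `0` and `1`. -/
theorem E6v_refl (e : Fin 9 → ℂ) : Rep reflAlg (-D) (E6v e) (E6v (swapExp e)) := by
  rw [E6v_eq, E6v_eq]
  refine rep_iff.2 ⟨6, _, rfl, ?_⟩
  refine Finset.sum_congr rfl fun j hj => ?_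
  have hj : j ≤ 6 := by have := Finset.mem_range.1 hj; omega
  have h := diffCoeff_refl (sOf e)
    (sym1 (e 0) (e 1) (e 2)) (sym1 (e 3) (e 4) (e 5)) (sym1 (e 6) (e 7) (e 8))
    (sym2 (e 0) (e 1) (e 2)) (sym2 (e 3) (e 4) (e 5)) (sym2 (e 6) (e 7) (e 8))
    (sym3 (e 0) (e 1) (e 2)) (sym3 (e 3) (e 4) (e 5)) (sym3 (e 6) (e 7) (e 8))
    (by rw [sOf]; ring) hj
  have h1 : e6Coeff (swapExp e) j = (-1) ^ j * (e6Coeff e j).comp (1 - X) := by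
    rw [e6Coeff, e6Coeff, h, sOf_swapExp]
    rfl
  change mulAlg (algebraMap ℂ[X] K (e6Coeff (swapExp e) j)) * D ^ j =
    mulAlg (refl (algebraMap ℂ[X] K (e6Coeff e j))) * (-D) ^ j
  rw [h1]
  rw [refl_algebraMap, map_mul, map_pow, map_neg, map_one, neg_pow D, map_mul, map_pow, map_neg,
    map_one, ← mul_assoc, (Commute.neg_one_left _).pow_left _ |>.eq]

/-- Exponents of the adjoint operator. -/
def dualExp (e : Fin 9 → ℂ) : Fin 9 → ℂ :=
  ![2 - e 0, 2 - e 1, 2 - e 2, 2 - e 3, 2 - e 4, 2 - e 5, 1 - e 6, 1 - e 7, 1 - e 8]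

theorem dualExp_dualExp (e : Fin 9 → ℂ) : dualExp (dualExp e) = e := by
  funext i; fin_cases i <;> simp [dualExp]

theorem sOf_dualExp (e : Fin 9 → ℂ) : sOf (dualExp e) = -1 - sOf e := by
  change -(sym1 (2 - e 0) (2 - e 1) (2 - e 2) + sym1 (2 - e 3) (2 - e 4) (2 - e 5) +
    sym1 (1 - e 6) (1 - e 7) (1 - e 8) - 6) / 3 = _
  rw [sOf, sym1, sym1, sym1, sym1, sym1, sym1]
  ring

/-- The cubic factor of `T₀`. -/
def b0 (e : Fin 9 → ℂ) (t : ℂ) : ℂ := (t + e 6) * (t + e 7) * (t + e 8)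

/-- The cubic factor of `T₁`. -/
def b1 (e : Fin 9 → ℂ) (t : ℂ) : ℂ :=
  -3 * t ^ 3 + (-9 + sym1 (e 0) (e 1) (e 2) - 2 * sym1 (e 6) (e 7) (e 8)) * t ^ 2
    + coeffT11 (sym1 (e 0) (e 1) (e 2)) (sym1 (e 3) (e 4) (e 5)) (sym1 (e 6) (e 7) (e 8))
      (sym2 (e 0) (e 1) (e 2)) (sym2 (e 3) (e 4) (e 5)) (sym2 (e 6) (e 7) (e 8)) * t
    + coeffT10 (sym1 (e 0) (e 1) (e 2)) (sym1 (e 3) (e 4) (e 5)) (sym1 (e 6) (e 7) (e 8))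
      (sym2 (e 0) (e 1) (e 2)) (sym2 (e 3) (e 4) (e 5)) (sym2 (e 6) (e 7) (e 8))
      (sym3 (e 0) (e 1) (e 2)) (sym3 (e 3) (e 4) (e 5)) (sym3 (e 6) (e 7) (e 8))

/-- The cubic factor of `T₂`. -/
def b2 (e : Fin 9 → ℂ) (t : ℂ) : ℂ :=
  3 * t ^ 3 + (18 + sym1 (e 6) (e 7) (e 8) - 2 * sym1 (e 0) (e 1) (e 2)) * t ^ 2
    + coeffT21 (sym1 (e 0) (e 1) (e 2)) (sym1 (e 3) (e 4) (e 5)) (sym1 (e 6) (e 7) (e 8))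
      (sym2 (e 0) (e 1) (e 2)) (sym2 (e 3) (e 4) (e 5)) (sym2 (e 6) (e 7) (e 8)) * t
    + coeffT20 (sym1 (e 0) (e 1) (e 2)) (sym1 (e 3) (e 4) (e 5)) (sym1 (e 6) (e 7) (e 8))
      (sym2 (e 0) (e 1) (e 2)) (sym2 (e 3) (e 4) (e 5)) (sym2 (e 6) (e 7) (e 8))
      (sym3 (e 0) (e 1) (e 2)) (sym3 (e 3) (e 4) (e 5)) (sym3 (e 6) (e 7) (e 8))

/-- The polynomial `T₃`. -/
def b3 (e : Fin 9 → ℂ) (t : ℂ) : ℂ := -((t + (3 - e 0)) * (t + (3 - e 1)) * (t + (3 - e 2)))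

theorem E6v_thetaForm (e : Fin 9 → ℂ) : ∃ T₀ T₁ T₂ T₃ : ℂ[X], E6v e = thetaForm T₀ T₁ T₂ T₃ ∧
    (∀ t, T₀.eval t = (t + sOf e + 2) * (t + sOf e + 1) * (t + sOf e) * b0 e t) ∧
    (∀ t, T₁.eval t = (t + sOf e + 2) * (t + sOf e + 1) * b1 e t) ∧
    (∀ t, T₂.eval t = (t + sOf e + 2) * b2 e t) ∧
    (∀ t, T₃.eval t = b3 e t) := by
  refine ⟨_, _, _, _, rfl, fun t => ?_, fun t => ?_, fun t => ?_, fun t => ?_⟩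
  · simp [b0, sOf, add_assoc]
  · simp [b1, sOf, add_assoc]
  · simp [b2, sOf, add_assoc]
  · simp [b3]

theorem b0_dualExp (e : Fin 9 → ℂ) (t : ℂ) : b0 (dualExp e) t = -b0 e (-t - 1) := by
  simp only [b0, dualExp, Matrix.cons_val]
  ring

theorem b1_dualExp (e : Fin 9 → ℂ) (t : ℂ) : b1 (dualExp e) t = -b1 e (-t - 2) := by
  simp only [b1, dualExp, Matrix.cons_val, coeffT10, coeffT11, sym1, sym2, sym3]
  ring

theorem b2_dualExp (e : Fin 9 → ℂ) (t : ℂ) : b2 (dualExp e) t = -b2 e (-t - 3) := by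
  simp only [b2, dualExp, Matrix.cons_val, coeffT10, coeffT20, coeffT21, sym1, sym2, sym3]
  ring

theorem b3_dualExp (e : Fin 9 → ℂ) (t : ℂ) : b3 (dualExp e) t = -b3 e (-t - 4) := by
  simp only [b3, dualExp, Matrix.cons_val]
  ring

theorem D_mul_theta : D * theta = (theta + 1) * D := by
  have h := isRep_D RatFunc.X
  rw [derivFun_X, map_one] at h
  change D * (mulAlg RatFunc.X * D) = (mulAlg RatFunc.X * D + 1) * D
  rw [← mul_assoc, h]

theorem D_mul_aeval (T : ℂ[X]) : D * aeval theta T = aeval theta (T.comp (X + 1)) * D := by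
  induction T using Polynomial.induction_on' with
  | add p q hp hq => rw [map_add, mul_add, hp, hq, add_comp, map_add, add_mul]
  | monomial n a =>
    have h : ∀ n : ℕ, D * theta ^ n = (theta + 1) ^ n * D := by
      intro n
      induction n with
      | zero => simp
      | succ n ih => rw [pow_succ, ← mul_assoc, ih, mul_assoc, D_mul_theta, ← mul_assoc, pow_succ]
    rw [aeval_monomial, ← mul_assoc, ← Algebra.commutes, mul_assoc, h, monomial_comp, map_mul,
      aeval_C, map_pow, map_add, aeval_X, map_one, mul_assoc]

/-- `∂ ^ j T(θ) = T(θ + j) ∂ ^ j`. -/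
theorem D_pow_mul_aeval (j : ℕ) (T : ℂ[X]) :
    D ^ j * aeval theta T = aeval theta (T.comp (X + C (j : ℂ))) * D ^ j := by
  induction j generalizing T with
  | zero => simp
  | succ j ih =>
    rw [pow_succ, mul_assoc, D_mul_aeval, ← mul_assoc, ih, mul_assoc]
    congr 2
    rw [comp_assoc]
    congr 1
    simp
    ring

open MulOpposite in
/-- The formal adjoint in terms of the Euler operator: `θ` becomes `-θ - 1`. -/
theorem isAdjoint_thetaForm {T T' : Fin 4 → ℂ[X]}
    (h : ∀ (i : Fin 4) t, (T' i).eval t = (-1) ^ (i : ℕ) * (T i).eval (-t - 1 - (i : ℕ))) :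
    IsAdjoint (thetaForm (T 0) (T 1) (T 2) (T 3)) (thetaForm (T' 0) (T' 1) (T' 2) (T' 3)) := by
  have h1 := Rep.thetaForm isRep_adjoint (T 0) (T 1) (T 2) (T 3)
  rw [IsAdjoint]
  convert h1 using 1
  have h2 : mulOpAlg RatFunc.X * op (-D) = op (-theta - 1) := by
    rw [mulOpAlg_apply, ← op_mul]
    congr 1
    have h := isRep_D RatFunc.X
    rw [derivFun_X, map_one] at h
    change -D * mulAlg RatFunc.X = -(mulAlg RatFunc.X * D) - 1
    rw [neg_mul, h, neg_add, sub_eq_add_neg]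
  have h3 : ∀ P : ℂ[X], aeval (op (-theta - 1)) P = op (aeval theta (P.comp (-X - 1))) := by
    intro P
    rw [aeval_comp, map_sub, map_neg, aeval_X, map_one]
    induction P using Polynomial.induction_on' with
    | add p q hp hq => rw [map_add, map_add, hp, hq, op_add]
    | monomial n a =>
      rw [aeval_monomial, aeval_monomial, op_mul, op_pow, Algebra.commutes]
      rfl
  have h4 : ∀ i : Fin 4, aeval (op (-theta - 1)) (T i) * (op (-D)) ^ (i : ℕ) =
      op (aeval theta (T' i) * D ^ (i : ℕ)) := by
    intro i
    rw [h3, ← op_pow, ← op_mul, neg_pow, mul_assoc, D_pow_mul_aeval, ← mul_assoc]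
    have h5 : T' i = C ((-1) ^ (i : ℕ)) *
        ((T i).comp (-X - 1)).comp (X + C ((i : ℕ) : ℂ)) := by
      refine Polynomial.funext fun t => ?_
      rw [h]
      simp only [eval_mul, eval_C, eval_comp, eval_sub, eval_neg, eval_X, eval_one, eval_add]
      congr 2
      ring
    rw [h5, map_mul, aeval_C, map_pow, map_neg, map_one]
  have h40 := h4 0
  have h41 := h4 1
  have h42 := h4 2
  have h43 := h4 3
  simp only [Fin.val_zero, Fin.val_one, Fin.val_two, pow_zero, pow_one, mul_one,
    show ((3 : Fin 4) : ℕ) = 3 from rfl] at h40 h41 h42 h43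
  rw [h2, h40, h41, h42, h43, ← op_add, ← op_add, ← op_add]
  rfl

theorem isAdjoint_E6v (e : Fin 9 → ℂ) : IsAdjoint (E6v e) (E6v (dualExp e)) := by
  obtain ⟨T₀, T₁, T₂, T₃, h, h0, h1, h2, h3⟩ := E6v_thetaForm e
  obtain ⟨U₀, U₁, U₂, U₃, h', h0', h1', h2', h3'⟩ := E6v_thetaForm (dualExp e)
  rw [h, h']
  refine isAdjoint_thetaForm (T := ![T₀, T₁, T₂, T₃]) (T' := ![U₀, U₁, U₂, U₃]) fun i t => ?_
  fin_cases i
  · simp [h0, h0', b0_dualExp, sOf_dualExp]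
    ring
  · simp [h1, h1', b1_dualExp, sOf_dualExp]
    ring_nf
  · simp [h2, h2', b2_dualExp, sOf_dualExp]
    ring_nf
  · simp [h3, h3', b3_dualExp]
    ring_nf

theorem isReducible_of_dualExp {e : Fin 9 → ℂ} (h : IsReducible (E6v (dualExp e))) :
    IsReducible (E6v e) := by
  have h1 := isAdjoint_E6v (dualExp e)
  rw [dualExp_dualExp] at h1
  exact h1.isReducible h

theorem isReducible_of_swapExp {e : Fin 9 → ℂ} (h : IsReducible (E6v (swapExp e))) :
    IsReducible (E6v e) := by
  have h1 := E6v_refl (swapExp e)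
  rw [swapExp_swapExp] at h1
  exact isReducible_of_refl h1 h

/-! ### Formal solutions `x ^ λ ∑ v_m x ^ m` -/

section Laurent

open scoped LaurentSeries RatFunc

instance : IsScalarTower ℂ K ℂ⸨X⸩ := by
  refine IsScalarTower.of_algebraMap_smul fun z v => ?_
  have h : algebraMap ℂ K z = algebraMap ℂ[X] K (C z) := rfl
  rw [Algebra.smul_def, h, ← IsScalarTower.algebraMap_apply]
  change HahnSeries.ofPowerSeries ℤ ℂ ((C z : ℂ[X]) : PowerSeries ℂ) * v = _
  rw [Polynomial.coe_C, PowerSeries.coe_C, HahnSeries.C_mul_eq_smul]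

/-- The derivation `d/dx` of the field of formal Laurent series. -/
def derL : Module.End ℂ ℂ⸨X⸩ := LaurentSeries.derivative ℂ

theorem derL_coeff (v : ℂ⸨X⸩) (m : ℤ) : (derL v).coeff m = (m + 1) * v.coeff (m + 1) := by
  simp [derL]

/-- Leibniz rule. It is checked for the Euler operator `x d/dx`, which does not enlarge supports. -/
theorem derL_mul (u v : ℂ⸨X⸩) : derL (u * v) = derL u * v + u * derL v := by
  have hX : ∀ w : ℂ⸨X⸩, ∀ m : ℤ, (HahnSeries.single 1 1 * derL w).coeff m = m * w.coeff m := by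
    intro w m
    rw [HahnSeries.coeff_single_mul, derL_coeff]
    simp
  have hsupp : ∀ w : ℂ⸨X⸩, (HahnSeries.single 1 1 * derL w).support ⊆ w.support := by
    intro w m hm
    rw [HahnSeries.mem_support, hX] at hm
    exact fun h => hm (by rw [h, mul_zero])
  have h1 : (HahnSeries.single 1 1 : ℂ⸨X⸩) ≠ 0 := by
    simp
  refine mul_left_cancel₀ h1 ?_
  rw [mul_add, ← mul_assoc, mul_left_comm _ u]
  ext m
  rw [hX, HahnSeries.coeff_add, HahnSeries.coeff_mul, HahnSeries.coeff_mul_left' u.isPWO_support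
    (hsupp u), HahnSeries.coeff_mul_right' v.isPWO_support (hsupp v), ← Finset.sum_add_distrib,
    Finset.mul_sum]
  refine Finset.sum_congr rfl fun ij hij => ?_
  rw [hX, hX, ← (Finset.mem_antidiagonal.1 hij).2.2]
  push_cast
  ring

theorem algebraMap_polynomial_coeff (p : ℂ[X]) (m : ℤ) :
    (algebraMap ℂ[X] ℂ⸨X⸩ p).coeff m = if 0 ≤ m then p.coeff m.toNat else 0 := by
  change (HahnSeries.ofPowerSeries ℤ ℂ (p : PowerSeries ℂ)).coeff m = _
  rw [PowerSeries.coeff_coe]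
  by_cases h : 0 ≤ m
  · rw [if_neg (not_lt.2 h), if_pos h, Polynomial.coeff_coe]
    congr 1
    omega
  · rw [if_pos (not_le.1 h), if_neg h]

theorem derL_polynomial (p : ℂ[X]) :
    derL (algebraMap ℂ[X] ℂ⸨X⸩ p) = algebraMap ℂ[X] ℂ⸨X⸩ (derivative p) := by
  ext m
  rw [derL_coeff, algebraMap_polynomial_coeff, algebraMap_polynomial_coeff]
  rcases lt_trichotomy m (-1) with h | rfl | h
  · rw [if_neg (by omega), if_neg (by omega), mul_zero]
  · simp
  · obtain ⟨k, rfl⟩ := Int.eq_ofNat_of_zero_le (show 0 ≤ m by omega)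
    rw [if_pos (by omega), if_pos (by omega), coeff_derivative]
    rw [show ((k : ℤ) + 1).toNat = k + 1 by omega, Int.toNat_natCast]
    push_cast
    ring

theorem derL_algebraMap (f : K) :
    derL (algebraMap K ℂ⸨X⸩ f) = algebraMap K ℂ⸨X⸩ (derivFun f) := by
  obtain ⟨u, v, hv, rfl⟩ := exists_frac f
  have hv' : algebraMap ℂ[X] K v ≠ 0 := RatFunc.algebraMap_ne_zero hv
  have hv2 : algebraMap K ℂ⸨X⸩ (algebraMap ℂ[X] K v) ≠ 0 := by simpa using hv
  have hp : ∀ p : ℂ[X], derL (algebraMap K ℂ⸨X⸩ (algebraMap ℂ[X] K p)) =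
      algebraMap K ℂ⸨X⸩ (algebraMap ℂ[X] K (derivative p)) := by
    intro p
    rw [← IsScalarTower.algebraMap_apply, ← IsScalarTower.algebraMap_apply]
    exact derL_polynomial p
  have h1 := derL_mul (algebraMap K ℂ⸨X⸩ (algebraMap ℂ[X] K u / algebraMap ℂ[X] K v))
    (algebraMap K ℂ⸨X⸩ (algebraMap ℂ[X] K v))
  rw [← map_mul, div_mul_cancel₀ _ hv', hp, hp] at h1
  refine mul_right_cancel₀ hv2 ?_
  rw [derivFun_div _ _ hv, eq_sub_of_add_eq h1.symm, ← map_mul, ← map_mul, ← map_sub]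
  congr 1
  field_simp

/-- The connection `d/dx + lam / x` on Laurent series: the action of `d/dx` on the formal products
`x ^ lam ∑ v_m x ^ m`. -/
def nabla (lam : ℂ) : Module.End ℂ ℂ⸨X⸩ :=
  derL + smulAlg ℂ⸨X⸩ (algebraMap ℂ K lam / RatFunc.X)

theorem isRep_nabla (lam : ℂ) : IsRep (smulAlg ℂ⸨X⸩) (nabla lam) := by
  intro f
  refine LinearMap.ext fun v => ?_
  simp only [nabla, Module.End.mul_apply, LinearMap.add_apply, smulAlg_apply, Algebra.smul_def,
    derL_mul, derL_algebraMap]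
  ring

theorem X_smul_coeff (v : ℂ⸨X⸩) (m : ℤ) :
    ((RatFunc.X : K) • v).coeff m = v.coeff (m - 1) := by
  rw [Algebra.smul_def, RatFunc.coe_X, HahnSeries.coeff_single_mul, one_mul]

theorem nabla_coeff (lam : ℂ) (v : ℂ⸨X⸩) (m : ℤ) :
    (nabla lam v).coeff m = (lam + m + 1) * v.coeff (m + 1) := by
  have h : ((algebraMap ℂ K lam / RatFunc.X) • v).coeff m = lam * v.coeff (m + 1) := by
    have h1 : (RatFunc.X : K) • (algebraMap ℂ K lam / RatFunc.X : K) • v = lam • v := by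
      rw [smul_smul, mul_div_cancel₀ _ RatFunc.X_ne_zero, algebraMap_smul]
    have h2 := X_smul_coeff ((algebraMap ℂ K lam / RatFunc.X : K) • v) (m + 1)
    rw [h1, add_sub_cancel_right] at h2
    rw [← h2]
    rfl
  rw [nabla, LinearMap.add_apply, HahnSeries.coeff_add, derL_coeff, smulAlg_apply, h]
  ring

theorem thetaL_coeff (lam : ℂ) (v : ℂ⸨X⸩) (m : ℤ) :
    ((smulAlg ℂ⸨X⸩ RatFunc.X * nabla lam) v).coeff m = (lam + m) * v.coeff m := by
  rw [Module.End.mul_apply, smulAlg_apply, X_smul_coeff, nabla_coeff, sub_add_cancel]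
  push_cast
  ring

theorem aeval_thetaL_coeff (lam : ℂ) (T : ℂ[X]) (v : ℂ⸨X⸩) (m : ℤ) :
    (aeval (smulAlg ℂ⸨X⸩ RatFunc.X * nabla lam) T v).coeff m = T.eval (lam + m) * v.coeff m := by
  induction T using Polynomial.induction_on' with
  | add p q hp hq =>
    rw [map_add, LinearMap.add_apply, HahnSeries.coeff_add, hp, hq, eval_add, add_mul]
  | monomial n a =>
    have h : ∀ n : ℕ, (((smulAlg ℂ⸨X⸩ RatFunc.X * nabla lam) ^ n) v).coeff m =
        (lam + m) ^ n * v.coeff m := by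
      intro n
      induction n with
      | zero => simp
      | succ n ih => rw [pow_succ', Module.End.mul_apply, thetaL_coeff, ih]; ring
    rw [aeval_monomial, eval_monomial, Module.End.mul_apply, Module.algebraMap_end_apply,
      HahnSeries.coeff_smul, h, smul_eq_mul, mul_assoc]

/-- The recurrence relation satisfied by the coefficients of the formal solutions
`x ^ lam ∑ v_m x ^ m` of `E₆(e)`; it also makes sense for two-sided sequences. -/
def SolRec (e : Fin 9 → ℂ) (lam : ℂ) (v : ℤ → ℂ) : Prop :=
  ∀ m : ℤ, (lam + m + sOf e + 2) * (lam + m + sOf e + 1) * (lam + m + sOf e) * b0 e (lam + m) * v m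
    + (lam + m + sOf e + 2) * (lam + m + sOf e + 1) * b1 e (lam + m) * ((lam + m + 1) * v (m + 1))
    + (lam + m + sOf e + 2) * b2 e (lam + m) * ((lam + m + 1) * (lam + m + 2) * v (m + 2))
    + b3 e (lam + m) * ((lam + m + 1) * (lam + m + 2) * (lam + m + 3) * v (m + 3)) = 0

theorem exists_rep_E6v (e : Fin 9 → ℂ) (lam : ℂ) (v : ℂ⸨X⸩) (hv : SolRec e lam v.coeff) :
    ∃ E', Rep (smulAlg ℂ⸨X⸩) (nabla lam) (E6v e) E' ∧ E' v = 0 := by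
  obtain ⟨T₀, T₁, T₂, T₃, h, h0, h1, h2, h3⟩ := E6v_thetaForm e
  rw [h]
  refine ⟨_, Rep.thetaForm (isRep_nabla lam) _ _ _ _, ?_⟩
  ext m
  simp only [LinearMap.add_apply, HahnSeries.coeff_add, pow_succ, pow_zero, one_mul]
  simp only [Module.End.mul_apply (aeval _ _), aeval_thetaL_coeff, nabla_coeff,
    Module.End.mul_apply (nabla lam), Module.End.mul_apply (nabla lam * nabla lam),
    h0, h1, h2, h3, HahnSeries.coeff_zero]
  refine Eq.trans ?_ (hv m)
  rw [show m + 1 + 1 = m + 2 by ring, show m + 2 + 1 = m + 3 by ring]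
  push_cast
  ring

/-- A formal solution lying in a small stable subspace makes `E₆(e)` reducible. -/
theorem isReducible_of_series (e : Fin 9 → ℂ) (lam : ℂ) {v : ℂ⸨X⸩} (hv0 : v ≠ 0)
    (hv : SolRec e lam v.coeff) (N : Submodule K ℂ⸨X⸩) [Module.Finite K N]
    (hN : Module.finrank K N < 6) (hvN : v ∈ N) (hstab : ∀ w ∈ N, nabla lam w ∈ N) :
    IsReducible (E6v e) := by
  obtain ⟨E', h1, h2⟩ := exists_rep_E6v e lam v hv
  obtain ⟨a, ha, h3⟩ := E6v_ordLE e
  exact isReducible_of_solution (isRep_nabla lam) ha h3 h1 hv0 h2 N hN hvN hstab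

theorem nabla_smul (lam : ℂ) (f : K) (v : ℂ⸨X⸩) :
    nabla lam (f • v) = f • nabla lam v + derivFun f • v := by
  have h := congrArg (fun T : Module.End ℂ ℂ⸨X⸩ => T v) (isRep_nabla lam f)
  exact h

/-- A solution `x ^ lam p(x)` with `p` a polynomial makes `E₆(e)` reducible. -/
theorem isReducible_of_polynomial (e : Fin 9 → ℂ) (lam : ℂ) {p : ℂ[X]} (hp : p ≠ 0)
    (hv : SolRec e lam fun m => if 0 ≤ m then p.coeff m.toNat else 0) : IsReducible (E6v e) := by
  have h1 : algebraMap ℂ[X] ℂ⸨X⸩ p ≠ 0 :=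
    fun h => hp (FaithfulSMul.algebraMap_injective ℂ[X] ℂ⸨X⸩ (h.trans (map_zero _).symm))
  refine isReducible_of_series e lam h1 ?_ (Submodule.span K {1}) ?_ ?_ ?_
  · convert hv using 1
    funext m
    exact algebraMap_polynomial_coeff p m
  · exact lt_of_le_of_lt (finrank_span_le_card _) (by simp)
  · refine Submodule.mem_span_singleton.2 ⟨algebraMap ℂ[X] K p, ?_⟩
    rw [Algebra.smul_def, mul_one, ← IsScalarTower.algebraMap_apply]
  · intro w hw
    obtain ⟨f, rfl⟩ := Submodule.mem_span_singleton.1 hw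
    refine Submodule.mem_span_singleton.2 ⟨f * (algebraMap ℂ K lam / RatFunc.X) + derivFun f, ?_⟩
    have h2 : derL 1 = 0 := by
      have := derL_polynomial 1
      simpa using this
    rw [nabla_smul, nabla, LinearMap.add_apply, h2, zero_add, smulAlg_apply, add_smul, mul_smul]

end Laurent

/-! ### Solutions `x ^ λ p(x)` with `p` a polynomial -/

/-- A four-term recurrence on the coefficients of a polynomial of degree at most `N` which imposes
only `N` conditions, in degrees `k, …, k + N - 1`, has a nonzero solution. -/
theorem exists_polynomial_of_recurrence (F : Fin 4 → ℤ → ℂ) (N : ℕ) (k : ℤ)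
    (hlow : ∀ m < k, ∀ j : Fin 4, 0 ≤ m + (j : ℕ) → m + (j : ℕ) ≤ N → F j m = 0)
    (hhigh : ∀ m, k + N ≤ m → ∀ j : Fin 4, 0 ≤ m + (j : ℕ) → m + (j : ℕ) ≤ N → F j m = 0) :
    ∃ p : ℂ[X], p ≠ 0 ∧ ∀ m : ℤ,
      ∑ j : Fin 4, F j m *
        (if 0 ≤ m + (j : ℕ) then p.coeff (m + (j : ℕ)).toNat else 0) = 0 := by
  let φ : degreeLT ℂ (N + 1) →ₗ[ℂ] (Fin N → ℂ) :=
    { toFun := fun p i => ∑ j : Fin 4, F j (k + (i : ℕ)) *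
        (if 0 ≤ k + (i : ℕ) + (j : ℕ) then (p : ℂ[X]).coeff (k + (i : ℕ) + (j : ℕ)).toNat else 0)
      map_add' := fun p q => by
        funext i
        simp only [Pi.add_apply, ← Finset.sum_add_distrib]
        refine Finset.sum_congr rfl fun j _ => ?_
        split_ifs
        · simp [mul_add]
        · simp
      map_smul' := fun z p => by
        funext i
        simp only [Pi.smul_apply, smul_eq_mul, RingHom.id_apply, Finset.mul_sum]
        refine Finset.sum_congr rfl fun j _ => ?_
        split_ifs
        · simp [mul_left_comm]
        · simp }
  have hdim : Module.finrank ℂ (degreeLT ℂ (N + 1)) = N + 1 := by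
    rw [(degreeLTEquiv ℂ (N + 1)).finrank_eq]
    simp
  have : Module.Finite ℂ (degreeLT ℂ (N + 1)) :=
    Module.Finite.equiv (degreeLTEquiv ℂ (N + 1)).symm
  have hker : LinearMap.ker φ ≠ ⊥ :=
    LinearMap.ker_ne_bot_of_finrank_lt (by rw [hdim]; simp)
  obtain ⟨p, hp, hp0⟩ := (Submodule.ne_bot_iff _).1 hker
  have hdeg : ∀ i : ℕ, N < i → (p : ℂ[X]).coeff i = 0 := fun i hi =>
    (mem_degreeLT.1 p.2 |>.trans_le (by exact_mod_cast hi)) |> coeff_eq_zero_of_degree_lt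
  refine ⟨p, fun h => hp0 (Subtype.ext h), fun m => ?_⟩
  have hzero : (∀ j : Fin 4, 0 ≤ m + (j : ℕ) → m + (j : ℕ) ≤ N → F j m = 0) →
      ∑ j : Fin 4, F j m *
        (if 0 ≤ m + (j : ℕ) then (p : ℂ[X]).coeff (m + (j : ℕ)).toNat else 0) = 0 := by
    intro h
    refine Finset.sum_eq_zero fun j _ => ?_
    split_ifs with h0
    · by_cases h1 : m + (j : ℕ) ≤ N
      · rw [h j h0 h1, zero_mul]
      · rw [hdeg _ (by omega), mul_zero]
    · rw [mul_zero]
  by_cases h1 : m < k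
  · exact hzero (hlow m h1)
  by_cases h2 : k + N ≤ m
  · exact hzero (hhigh m h2)
  obtain ⟨i, hi⟩ := Int.eq_ofNat_of_zero_le (show 0 ≤ m - k by omega)
  have h3 := congrFun (LinearMap.mem_ker.1 hp) ⟨i, by omega⟩
  have h4 : m = k + (i : ℕ) := by omega
  rw [h4]
  exact h3

/-- The four coefficients of the recurrence `SolRec`. -/
def solCoeff (e : Fin 9 → ℂ) (lam : ℂ) : Fin 4 → ℤ → ℂ :=
  ![fun m => (lam + m + sOf e + 2) * (lam + m + sOf e + 1) * (lam + m + sOf e) * b0 e (lam + m),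
    fun m => (lam + m + sOf e + 2) * (lam + m + sOf e + 1) * b1 e (lam + m) * (lam + m + 1),
    fun m => (lam + m + sOf e + 2) * b2 e (lam + m) * ((lam + m + 1) * (lam + m + 2)),
    fun m => b3 e (lam + m) * ((lam + m + 1) * (lam + m + 2) * (lam + m + 3))]

/-- A solution `x ^ lam p(x)` with `deg p ≤ N` exists if the recurrence imposes only `N` conditions on
the `N + 1` coefficients of `p`. -/
theorem isReducible_of_solCoeff (e : Fin 9 → ℂ) (lam : ℂ) (N : ℕ) (k : ℤ)
    (hlow : ∀ m < k, ∀ j : Fin 4, 0 ≤ m + (j : ℕ) → m + (j : ℕ) ≤ N → solCoeff e lam j m = 0)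
    (hhigh : ∀ m, k + N ≤ m → ∀ j : Fin 4, 0 ≤ m + (j : ℕ) → m + (j : ℕ) ≤ N →
      solCoeff e lam j m = 0) : IsReducible (E6v e) := by
  obtain ⟨p, hp, h⟩ := exists_polynomial_of_recurrence (solCoeff e lam) N k hlow hhigh
  refine isReducible_of_polynomial e lam hp fun m => ?_
  refine Eq.trans ?_ (h m)
  simp only [Fin.sum_univ_four, solCoeff, Matrix.cons_val, Fin.val_zero, Fin.val_one, Fin.val_two,
    show ((3 : Fin 4) : ℕ) = 3 from rfl, Nat.cast_zero, Nat.cast_one, Nat.cast_ofNat, add_zero]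
  ring

/-- If `T₀(N) = 0`, then `E₆` lowers the degree of polynomials of degree at most `N`, so it
annihilates one of them. -/
theorem isReducible_of_eval_eq_zero (e : Fin 9 → ℂ) (N : ℕ)
    (h : (N + sOf e) * b0 e N = 0) : IsReducible (E6v e) := by
  refine isReducible_of_solCoeff e 0 N 0 (fun m hm j h0 _ => ?_) (fun m hm j _ h1 => ?_)
  · have hj := j.2
    have hcases : (m = -1 ∧ 1 ≤ (j : ℕ)) ∨ (m = -2 ∧ 2 ≤ (j : ℕ)) ∨ (m = -3 ∧ 3 ≤ (j : ℕ)) := by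
      omega
    rcases hcases with ⟨rfl, hj1⟩ | ⟨rfl, hj1⟩ | ⟨rfl, hj1⟩ <;>
    · fin_cases j <;> simp [solCoeff] at hj1 ⊢
  · have hm' : m = N := by omega
    have hj : j = 0 := by
      refine Fin.ext ?_
      simp
      omega
    subst hm' hj
    simp only [solCoeff, Matrix.cons_val, zero_add, Int.cast_natCast]
    rw [mul_assoc, h, mul_zero]

/-- If the difference between `-s` and the exponent `e₁` at `0` is a natural number `N`, then
there is a solution `x ^ e₁ p(x)` with `p` a polynomial of degree at most `N`. -/
theorem isReducible_of_exponent (e : Fin 9 → ℂ) (N : ℕ) (h : e 0 + N + sOf e = 0) :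
    IsReducible (E6v e) := by
  refine isReducible_of_solCoeff e (e 0) N (-2) (fun m hm j h0 _ => ?_) (fun m hm j _ h1 => ?_)
  · have hj := j.2
    have hm' : m = -3 := by omega
    have hj : j = 3 := by
      refine Fin.ext ?_
      change (j : ℕ) = 3
      omega
    subst hm' hj
    simp only [solCoeff, b3, Matrix.cons_val]
    push_cast
    ring
  · have hcases : (m = N ∧ (j : ℕ) = 0) ∨ (m = N - 1 ∧ (j : ℕ) ≤ 1) ∨
        (m = N - 2 ∧ (j : ℕ) ≤ 2) := by
      omega
    rcases hcases with ⟨rfl, hj⟩ | ⟨rfl, hj⟩ | ⟨rfl, hj⟩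
    · have hj : j = 0 := Fin.ext hj
      subst hj
      simp [solCoeff, h]
    · have h2 : e 0 + ((N : ℤ) - 1 : ℤ) + sOf e + 1 = 0 := by
        rw [← h]; push_cast; ring
      fin_cases j <;> simp only [solCoeff, Matrix.cons_val, Fin.mk_one, Fin.zero_eta, h2,
        Fin.reduceFinMk] at hj ⊢ <;> first | omega | simp
    · have h2 : e 0 + ((N : ℤ) - 2 : ℤ) + sOf e + 2 = 0 := by
        rw [← h]; push_cast; ring
      fin_cases j <;> simp only [solCoeff, Matrix.cons_val, Fin.mk_one, Fin.zero_eta, h2,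
        Fin.reduceFinMk] at hj ⊢ <;> first | omega | simp

/-- Each of the exponents `s, e₇, e₈, e₉` at infinity being an integer makes `E₆` reducible. -/
theorem isReducible_of_isInt_infty (e : Fin 9 → ℂ)
    (h : IsInt (sOf e) ∨ IsInt (e 6) ∨ IsInt (e 7) ∨ IsInt (e 8)) : IsReducible (E6v e) := by
  -- a nonpositive exponent gives a polynomial solution, a positive one a solution of the adjoint
  have key : ∀ (n : ℤ) (e : Fin 9 → ℂ), n ≤ 0 →
      (sOf e = n ∨ e 6 = n ∨ e 7 = n ∨ e 8 = n) → IsReducible (E6v e) := by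
    intro n e hn h
    obtain ⟨N, hN⟩ := Int.eq_ofNat_of_zero_le (show 0 ≤ -n by omega)
    refine isReducible_of_eval_eq_zero e N ?_
    have hN' : (n : ℂ) = -N := by
      have : n = -(N : ℤ) := by omega
      rw [this]; push_cast; rfl
    rw [b0]
    rcases h with h | h | h | h <;> rw [h, hN'] <;> ring
  have main : ∀ n : ℤ, (sOf e = n ∨ e 6 = n ∨ e 7 = n ∨ e 8 = n) → IsReducible (E6v e) := by
    intro n h
    rcases le_or_gt n 0 with hn | hn
    · exact key n e hn h
    · refine isReducible_of_dualExp ?_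
      rcases h with h | h
      · refine key (-1 - n) _ (by omega) (Or.inl ?_)
        rw [sOf_dualExp, h]; push_cast; ring
      · refine key (1 - n) _ (by omega) (Or.inr ?_)
        change 1 - e 6 = _ ∨ 1 - e 7 = _ ∨ 1 - e 8 = _
        rcases h with h | h | h <;> simp [h]
  rcases h with ⟨n, h⟩ | ⟨n, h⟩ | ⟨n, h⟩ | ⟨n, h⟩
  · exact main n (Or.inl h)
  · exact main n (Or.inr (Or.inl h))
  · exact main n (Or.inr (Or.inr (Or.inl h)))
  · exact main n (Or.inr (Or.inr (Or.inr h)))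

/-- A nonpositive integer `e₁ + s` gives a solution `x ^ e₁ p(x)`, a positive one a solution of the
adjoint. -/
theorem isReducible_of_isInt_zero (e : Fin 9 → ℂ) (h : IsInt (e 0 + sOf e)) :
    IsReducible (E6v e) := by
  obtain ⟨n, hn⟩ := h
  rcases le_or_gt n 0 with h0 | h0
  · obtain ⟨N, hN⟩ := Int.eq_ofNat_of_zero_le (show 0 ≤ -n by omega)
    refine isReducible_of_exponent e N ?_
    have : n = -(N : ℤ) := by omega
    rw [add_right_comm, hn, this]; push_cast; ring
  · refine isReducible_of_dualExp ?_
    obtain ⟨N, hN⟩ := Int.eq_ofNat_of_zero_le (show 0 ≤ n - 1 by omega)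
    refine isReducible_of_exponent _ N ?_
    rw [sOf_dualExp]
    change 2 - e 0 + N + (-1 - sOf e) = 0
    have h1 : (n : ℂ) = N + 1 := by
      have : n = (N : ℤ) + 1 := by omega
      rw [this]; push_cast; rfl
    linear_combination -hn - h1

/-! ### Euler transforms of `x ^ p (1 - x) ^ q f(x)` -/

section Gauss

open scoped LaurentSeries RatFunc

theorem not_isInt_add {z : ℂ} (h : ¬ IsInt z) (n : ℤ) : z + n ≠ 0 := fun h0 =>
  h ⟨-n, by push_cast; linear_combination h0⟩

/-- The `n`-th Taylor coefficient of `(1 - x) ^ q`, up to the constant factor `Γ(-q)`; it is `0`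
for `n < 0` since `1 / Γ` is extended by `0` at the poles of `Γ`. -/
def binSeq (q : ℂ) (n : ℤ) : ℂ := Complex.Gamma (n - q) * (Complex.Gamma (n + 1))⁻¹

theorem Gamma_succ_of_not_isInt {z : ℂ} (h : ¬ IsInt z) (n : ℤ) :
    Complex.Gamma (z + n + 1) = (z + n) * Complex.Gamma (z + n) :=
  Complex.Gamma_add_one _ (not_isInt_add h n)

/-- Four consecutive terms of `binSeq` in terms of a common factor `Y`, without denominators. -/
theorem exists_binSeq_eq {q : ℂ} (hq : ¬ IsInt q) (n : ℤ) : ∃ Y,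
    binSeq q n = (n + 3) * (n + 2) * (n + 1) * Y ∧
    binSeq q (n + 1) = (n + 3) * (n + 2) * (n - q) * Y ∧
    binSeq q (n + 2) = (n + 3) * (n - q) * (n + 1 - q) * Y ∧
    binSeq q (n + 3) = (n - q) * (n + 1 - q) * (n + 2 - q) * Y := by
  have hq' : ¬ IsInt (-q) := fun ⟨k, hk⟩ => hq ⟨-k, by push_cast; rw [← hk]; ring⟩
  have hG : ∀ k : ℤ, Complex.Gamma (k + 1 - q) = (k - q) * Complex.Gamma (k - q) := by
    intro k
    have := Gamma_succ_of_not_isInt hq' k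
    rw [show (k : ℂ) + 1 - q = -q + k + 1 by ring, this]
    ring_nf
  have hI : ∀ k : ℤ, (Complex.Gamma ((k : ℂ) + 1))⁻¹ =
      (k + 1) * (Complex.Gamma ((k : ℂ) + 2))⁻¹ := by
    intro k
    rw [Complex.one_div_Gamma_eq_self_mul_one_div_Gamma_add_one]
    ring_nf
  have h1 := hG n
  have h2 := hG (n + 1)
  have h3 := hG (n + 2)
  have i0 := hI n
  have i1 := hI (n + 1)
  have i2 := hI (n + 2)
  push_cast at h2 h3 i1 i2
  rw [show (n : ℂ) + 1 + 1 = n + 2 by ring] at h2 i1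
  rw [show (n : ℂ) + 1 + 2 = n + 3 by ring] at i1
  rw [show (n : ℂ) + 2 + 1 = n + 3 by ring] at h3 i2
  rw [show (n : ℂ) + 2 + 2 = n + 4 by ring] at i2
  refine ⟨Complex.Gamma (n - q) * (Complex.Gamma (n + 4))⁻¹, ?_, ?_, ?_, ?_⟩
  · rw [binSeq, i0, i1, i2]; ring
  · rw [binSeq]; push_cast
    rw [show (n : ℂ) + 1 + 1 = n + 2 by ring, i1, i2, h1]; ring
  · rw [binSeq]; push_cast
    rw [show (n : ℂ) + 2 + 1 = n + 3 by ring, i2, h2, h1]; ring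
  · rw [binSeq]; push_cast
    rw [show (n : ℂ) + 3 + 1 = n + 4 by ring, h3, h2, h1]; ring

theorem binSeq_succ {q : ℂ} (hq : ¬ IsInt q) (n : ℤ) : ∃ Y,
    binSeq q n = (n + 1) * Y ∧ binSeq q (n + 1) = (n - q) * Y := by
  obtain ⟨Y, h0, h1, -, -⟩ := exists_binSeq_eq hq n
  exact ⟨(n + 3) * (n + 2) * Y, by rw [h0]; ring, by rw [h1]; ring⟩

theorem binSeq_of_neg (q : ℂ) {n : ℤ} (hn : n < 0) : binSeq q n = 0 := by
  obtain ⟨k, hk⟩ := Int.eq_ofNat_of_zero_le (show 0 ≤ -n - 1 by omega)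
  have h : (n : ℂ) + 1 = -(k : ℂ) := by
    have : n = -(k : ℤ) - 1 := by omega
    rw [this]; push_cast; ring
  rw [binSeq, h, Complex.Gamma_neg_nat_eq_zero, inv_zero, mul_zero]

theorem binSeq_zero_ne {q : ℂ} (hq : ¬ IsInt q) : binSeq q 0 ≠ 0 := by
  rw [binSeq]
  refine mul_ne_zero ?_ ?_
  · refine Complex.Gamma_ne_zero fun m h => hq ⟨m, ?_⟩
    push_cast at h ⊢
    linear_combination -h
  · simp

/-- Multipliers of the Euler transform: the transform of `x ^ (p + i)` is a constant multiple of
`x ^ (c + i)`, with constant `Γ(p + 1 + i) / Γ(c + 1 + i)`. -/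
def eulerSeq (p c : ℂ) (i : ℤ) : ℂ := Complex.Gamma (p + 1 + i) * (Complex.Gamma (c + 1 + i))⁻¹

theorem eulerSeq_succ {p : ℂ} (hp : ¬ IsInt p) (c : ℂ) (i : ℤ) : ∃ W,
    eulerSeq p c i = (c + 1 + i) * W ∧ eulerSeq p c (i + 1) = (p + 1 + i) * W := by
  refine ⟨Complex.Gamma (p + 1 + i) * (Complex.Gamma (c + 2 + i))⁻¹, ?_, ?_⟩
  · rw [eulerSeq, Complex.one_div_Gamma_eq_self_mul_one_div_Gamma_add_one (c + 1 + i)]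
    ring_nf
  · have h := Gamma_succ_of_not_isInt hp (i + 1)
    push_cast at h
    rw [eulerSeq]
    push_cast
    rw [show p + 1 + ((i : ℂ) + 1) = p + (i + 1) + 1 by ring, h]
    ring_nf

theorem eulerSeq_ne_zero {p : ℂ} (hp : ¬ IsInt p) {c : ℂ} {i : ℤ}
    (h : ∀ n : ℕ, c + 1 + i ≠ -n) : eulerSeq p c i ≠ 0 := by
  refine mul_ne_zero ?_ (inv_ne_zero (Complex.Gamma_ne_zero h))
  refine Complex.Gamma_ne_zero fun m hm => hp ⟨-m - 1 - i, ?_⟩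
  push_cast
  linear_combination hm

/-- The Euler transform of `x ^ (p + k) (1 - x) ^ q`, divided by `x ^ c`. -/
def gaussSeries (p q c : ℂ) (k : ℕ) : ℂ⸨X⸩ :=
  HahnSeries.ofSuppBddBelow (fun i : ℤ => eulerSeq p c i * binSeq q (i - k)) <| by
    refine ⟨k, fun i hi => ?_⟩
    by_contra h
    exact hi (by simp only; rw [binSeq_of_neg q (by omega), mul_zero])

theorem gaussSeries_coeff (p q c : ℂ) (k : ℕ) (i : ℤ) :
    (gaussSeries p q c k).coeff i = eulerSeq p c i * binSeq q (i - k) := rfl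

/-- Contiguity relation between three consecutive transforms. -/
theorem gaussSeries_recurrence {p q : ℂ} (hp : ¬ IsInt p) (hq : ¬ IsInt q) (c : ℂ)
    (k : ℕ) :
    (q + c + k + 2) • gaussSeries p q c (k + 2) =
      (c + k + 1) • gaussSeries p q c (k + 1) + (RatFunc.X : K) •
        ((p + q + k + 2) • gaussSeries p q c (k + 1) - (p + k + 1) • gaussSeries p q c k) := by
  ext i
  simp only [HahnSeries.coeff_smul, HahnSeries.coeff_add, HahnSeries.coeff_sub, X_smul_coeff,
    gaussSeries_coeff, smul_eq_mul]
  obtain ⟨W, h1, h2⟩ := eulerSeq_succ hp c (i - 1)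
  obtain ⟨Y, h3, h4⟩ := binSeq_succ hq (i - k - 2)
  rw [sub_add_cancel] at h2
  rw [show i - k - 2 + 1 = i - k - 1 by ring] at h4
  push_cast at *
  rw [show i - ((k : ℤ) + 2) = i - k - 2 by ring, show i - ((k : ℤ) + 1) = i - k - 1 by ring,
    show i - 1 - ((k : ℤ) + 1) = i - k - 2 by ring, show i - 1 - (k : ℤ) = i - k - 1 by ring,
    h1, h2, h3, h4]
  ring

theorem gaussSeries_deriv {p q : ℂ} (hp : ¬ IsInt p) (hq : ¬ IsInt q) (c : ℂ) (k : ℕ) :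
    (1 - RatFunc.X : K) • (RatFunc.X : K) • nabla c (gaussSeries p q c k) =
      (c + k) • gaussSeries p q c k -
        (RatFunc.X : K) • (c - p - 1) • gaussSeries p q c k -
        (q + c + k + 1) • gaussSeries p q c (k + 1) := by
  have hs : ∀ w : ℂ⸨X⸩, (1 - RatFunc.X : K) • w = w - (RatFunc.X : K) • w := fun w => by
    rw [Algebra.smul_def, map_sub, map_one, sub_mul, one_mul, ← Algebra.smul_def]
  rw [hs]
  ext i
  simp only [HahnSeries.coeff_smul, HahnSeries.coeff_sub, X_smul_coeff,
    gaussSeries_coeff, nabla_coeff, smul_eq_mul]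
  obtain ⟨W, h1, h2⟩ := eulerSeq_succ hp c (i - 1)
  obtain ⟨Y, h3, h4⟩ := binSeq_succ hq (i - k - 1)
  rw [sub_add_cancel] at h2 h4
  push_cast at *
  rw [sub_add_cancel, sub_add_cancel, show i - ((k : ℤ) + 1) = i - k - 1 by ring,
    show i - 1 - (k : ℤ) = i - k - 1 by ring, h1, h2, h3, h4]
  ring

/-- All the transforms lie in a stable plane over `ℂ(x)`, spanned by the first two. -/
theorem exists_gauss_plane {p q : ℂ} (hp : ¬ IsInt p) (hq : ¬ IsInt q) (c : ℂ)
    (hqc : ¬ IsInt (q + c)) : ∃ N : Submodule K ℂ⸨X⸩,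
    Module.Finite K N ∧ Module.finrank K N < 6 ∧ (∀ k, gaussSeries p q c k ∈ N) ∧
      ∀ w ∈ N, nabla c w ∈ N := by
  classical
  let s : Finset ℂ⸨X⸩ := {gaussSeries p q c 0, gaussSeries p q c 1}
  let N : Submodule K ℂ⸨X⸩ := Submodule.span K s
  have hsm : ∀ (z : ℂ) (w : ℂ⸨X⸩), w ∈ N → z • w ∈ N := by
    intro z w hw
    rw [← algebraMap_smul K z w]
    exact N.smul_mem _ hw
  have hmem : ∀ k, gaussSeries p q c k ∈ N ∧ gaussSeries p q c (k + 1) ∈ N := by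
    intro k
    induction k with
    | zero =>
      exact ⟨Submodule.subset_span (by simp [s]), Submodule.subset_span (by simp [s])⟩
    | succ k ih =>
      refine ⟨ih.2, ?_⟩
      have h0 : q + c + k + 2 ≠ 0 := by
        have := not_isInt_add hqc (k + 2)
        push_cast at this
        rwa [← add_assoc] at this
      have h1 := gaussSeries_recurrence hp hq c k
      have h2 : (q + c + k + 2) • gaussSeries p q c (k + 2) ∈ N := by
        rw [h1]
        exact N.add_mem (hsm _ _ ih.2)
          (N.smul_mem _ (N.sub_mem (hsm _ _ ih.2) (hsm _ _ ih.1)))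
      have h3 := hsm (q + c + k + 2)⁻¹ _ h2
      rwa [smul_smul, inv_mul_cancel₀ h0, one_smul] at h3
  have hX : (1 - RatFunc.X : K) ≠ 0 := by
    intro h
    have h1 : algebraMap ℂ[X] K (1 - X) = 0 := by
      rw [map_sub, map_one, RatFunc.algebraMap_X, h]
    have h2 : (1 - X : ℂ[X]) = 0 :=
      RatFunc.algebraMap_injective ℂ (h1.trans (map_zero _).symm)
    have h3 := congrArg (eval 0) h2
    simp at h3
  have hder : ∀ k, nabla c (gaussSeries p q c k) ∈ N := by
    intro k
    have h1 := gaussSeries_deriv hp hq c k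
    have h2 : (1 - RatFunc.X : K) • (RatFunc.X : K) • nabla c (gaussSeries p q c k) ∈ N := by
      rw [h1]
      exact N.sub_mem (N.sub_mem (hsm _ _ (hmem k).1) (N.smul_mem _ (hsm _ _ (hmem k).1)))
        (hsm _ _ (hmem k).2)
    have hX0 : (RatFunc.X : K) ≠ 0 := RatFunc.X_ne_zero
    exact (N.smul_mem_iff hX0).1 ((N.smul_mem_iff hX).1 h2)
  refine ⟨N, Module.Finite.span_finset K s, ?_, fun k => (hmem k).1, fun w hw => ?_⟩
  · refine lt_of_le_of_lt (finrank_span_finset_le_card s) ?_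
    exact lt_of_le_of_lt Finset.card_le_two (by norm_num)
  · induction hw using Submodule.span_induction with
    | mem x hx =>
      have : x = gaussSeries p q c 0 ∨ x = gaussSeries p q c 1 := by simpa [s] using hx
      rcases this with rfl | rfl <;> exact hder _
    | zero => rw [map_zero]; exact N.zero_mem
    | add x y _ _ hx hy => rw [map_add]; exact N.add_mem hx hy
    | smul a x hx hx' =>
      rw [nabla_smul]
      exact N.add_mem (N.smul_mem _ hx') (N.smul_mem _ hx)

end Gauss

/-! ### The third-order operator behind `E₆`

An Euler transform turns the solutions of `∑ b_j(θ + 1 - s) x ^ (-j)`, an operator of order three, into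
solutions of `E₆`. Conjugating this operator by `x ^ p (1 - x) ^ q` and dividing by `x ^ (-2) (1 - x)`
gives the reduced operator `x ^ m ↦ A(m) x ^ (m + 1) + B(m) x ^ m + C(m) x ^ (m - 1)`, which acts on
polynomials. -/

section Tridiagonal

open scoped LaurentSeries RatFunc

/-- The exponent at `1` of the factor `(1 - x) ^ q`. -/
def qOf (e : Fin 9 → ℂ) : ℂ := e 3 + sOf e - 1

/-- Coefficient `A(m)` of the reduced operator. -/
def triA (e : Fin 9 → ℂ) (m : ℂ) : ℂ := -b0 e (e 0 + qOf e + m)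

/-- Coefficient `B(m)` of the reduced operator. -/
def triB (e : Fin 9 → ℂ) (m : ℂ) : ℂ :=
  b2 e (e 0 + m - 2) - qOf e * b3 e (e 0 + m - 2) + (1 + qOf e) * b3 e (e 0 + m - 3)

/-- Coefficient `C(m)` of the reduced operator. -/
def triC (e : Fin 9 → ℂ) (m : ℂ) : ℂ := b3 e (e 0 + m - 3)

/-- The operator of order three applied to `x ^ (p + m) (1 - x) ^ q` is the product of
`x ^ (p - 2) (1 - x) ^ (q + 1)` with the image of `x ^ m` under the reduced operator. The identity compares
coefficients, with four consecutive terms of `binSeq` written as in `exists_binSeq_eq`. -/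
theorem tri_identity (e : Fin 9 → ℂ) (m n : ℂ) :
    b0 e (e 0 + m + n) * ((n + 3) * (n + 2) * (n + 1))
      + b1 e (e 0 + m + n) * ((n + 3) * (n + 2) * (n - qOf e))
      + b2 e (e 0 + m + n) * ((n + 3) * (n - qOf e) * (n + 1 - qOf e))
      + b3 e (e 0 + m + n) * ((n - qOf e) * (n + 1 - qOf e) * (n + 2 - qOf e)) =
    triA e m * ((n + 3) * (n + 2) * (n - qOf e) - (n + 3) * (n + 2) * (n + 1))
      + triB e m * ((n + 3) * (n - qOf e) * (n + 1 - qOf e) - (n + 3) * (n + 2) * (n - qOf e))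
      + triC e m * ((n - qOf e) * (n + 1 - qOf e) * (n + 2 - qOf e)
        - (n + 3) * (n - qOf e) * (n + 1 - qOf e)) := by
  obtain ⟨s, hs⟩ : ∃ s, s = sOf e := ⟨_, rfl⟩
  have h8 : e 8 = 6 - 3 * s - e 0 - e 1 - e 2 - e 3 - e 4 - e 5 - e 6 - e 7 := by
    rw [hs, sOf, sym1, sym1, sym1]; ring
  simp only [triA, triB, triC, b0, b1, b2, b3, qOf, ← hs, h8, coeffT10, coeffT11, coeffT20,
    coeffT21, sym1, sym2, sym3]
  ring

/-- The coefficients of `(1 - x) ^ q ∑_{k < M} f_k x ^ k`, in the normalization of `binSeq`. -/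
def mixSeq (q : ℂ) (f : ℕ → ℂ) (M : ℕ) (i : ℤ) : ℂ :=
  ∑ k ∈ Finset.range M, f k * binSeq q (i - k)

/-- A polynomial killed by the reduced operator gives a solution of the operator of order three. -/
theorem mixSeq_recurrence {e : Fin 9 → ℂ} (hq : ¬ IsInt (qOf e)) {f : ℕ → ℂ} {M : ℕ}
    (hf : ∀ k, M ≤ k → f k = 0) (h0 : triB e 0 * f 0 + triC e 1 * f 1 = 0)
    (hrec : ∀ k : ℕ, triA e k * f k + triB e (k + 1) * f (k + 1) + triC e (k + 2) * f (k + 2) = 0)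
    (i : ℤ) :
    b0 e (e 0 + i) * mixSeq (qOf e) f (M + 1) i + b1 e (e 0 + i) * mixSeq (qOf e) f (M + 1) (i + 1)
      + b2 e (e 0 + i) * mixSeq (qOf e) f (M + 1) (i + 2)
      + b3 e (e 0 + i) * mixSeq (qOf e) f (M + 1) (i + 3) = 0 := by
  let V : ℤ → ℂ := fun k => binSeq (qOf e) (i + 2 - k) - binSeq (qOf e) (i + 1 - k)
  have hterm : ∀ k : ℕ, b0 e (e 0 + i) * (f k * binSeq (qOf e) (i - k))
      + b1 e (e 0 + i) * (f k * binSeq (qOf e) (i + 1 - k))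
      + b2 e (e 0 + i) * (f k * binSeq (qOf e) (i + 2 - k))
      + b3 e (e 0 + i) * (f k * binSeq (qOf e) (i + 3 - k)) =
      triA e k * f k * V (k + 1) + triB e k * f k * V k + triC e k * f k * V (k - 1) := by
    intro k
    obtain ⟨Y, y0, y1, y2, y3⟩ := exists_binSeq_eq hq (i - k)
    have h := tri_identity e k (i - k)
    rw [show e 0 + (k : ℂ) + ((i : ℂ) - k) = e 0 + i by ring] at h
    simp only [V]
    rw [show i + 2 - ((k : ℤ) + 1) = i - k + 1 by ring, show i + 1 - ((k : ℤ) + 1) = i - k by ring,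
      show i + 2 - (k : ℤ) = i - k + 2 by ring, show i + 1 - (k : ℤ) = i - k + 1 by ring,
      show i + 2 - ((k : ℤ) - 1) = i - k + 3 by ring,
      show i + 1 - ((k : ℤ) - 1) = i - k + 2 by ring,
      show i + 3 - (k : ℤ) = i - k + 3 by ring, y0, y1, y2, y3]
    push_cast
    linear_combination (f k * Y) * h
  have hsum : ∀ m : ℕ, ∑ k ∈ Finset.range (m + 1),
      (triA e k * f k * V (k + 1) + triB e k * f k * V k + triC e k * f k * V (k - 1)) =
      triA e m * f m * V (m + 1) - triC e (m + 1) * f (m + 1) * V m := by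
    intro m
    induction m with
    | zero =>
      have hC : triC e 0 = 0 := by simp only [triC, b3]; ring
      rw [zero_add, Finset.sum_range_one]
      simp only [Nat.cast_zero, zero_add, hC]
      linear_combination V 0 * h0
    | succ m ih =>
      rw [Finset.sum_range_succ, ih]
      have := hrec m
      push_cast
      rw [show (m : ℤ) + 1 - 1 = m by ring, show (m : ℂ) + 1 + 1 = m + 2 by ring]
      linear_combination V (m + 1) * this
  have h1 := hsum M
  rw [hf M le_rfl, hf (M + 1) (by omega)] at h1
  rw [mul_zero, mul_zero, zero_mul, zero_mul, sub_zero] at h1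
  rw [← h1]
  simp only [mixSeq, Finset.mul_sum, ← Finset.sum_add_distrib]
  exact Finset.sum_congr rfl fun k _ => hterm k

/-- A polynomial killed by the reduced operator makes `E₆` reducible, provided that the Euler
transforms involved are nonresonant. -/
theorem isReducible_of_tri {e : Fin 9 → ℂ} (hp : ¬ IsInt (e 0 + sOf e))
    (hq : ¬ IsInt (e 3 + sOf e)) (hqc : ¬ IsInt (e 0 + e 3 + sOf e))
    (h6 : ¬ IsInt (e 6)) (h7 : ¬ IsInt (e 7)) (h8 : ¬ IsInt (e 8))
    {f : ℕ → ℂ} {M : ℕ} (hf : ∀ k, M ≤ k → f k = 0) (hfne : ∃ k, f k ≠ 0)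
    (h0 : triB e 0 * f 0 + triC e 1 * f 1 = 0)
    (hrec : ∀ k : ℕ, triA e k * f k + triB e (k + 1) * f (k + 1) + triC e (k + 2) * f (k + 2) = 0) :
    IsReducible (E6v e) := by
  have hsub : ∀ z : ℂ, ¬ IsInt z → ¬ IsInt (z - 1) := fun z hz ⟨n, hn⟩ =>
    hz ⟨n + 1, by push_cast; rw [← hn]; ring⟩
  have hp' : ¬ IsInt (e 0 + sOf e - 1) := hsub _ hp
  have hq' : ¬ IsInt (qOf e) := hsub _ hq
  have hqc' : ¬ IsInt (qOf e + e 0) := by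
    have := hsub _ hqc
    rwa [show qOf e + e 0 = e 0 + e 3 + sOf e - 1 by rw [qOf]; ring]
  have hmix := mixSeq_recurrence hq' hf h0 hrec
  obtain ⟨N, hN1, hN2, hN3, hN4⟩ := exists_gauss_plane hp' hq' (e 0) hqc'
  set w : ℤ → ℂ := eulerSeq (e 0 + sOf e - 1) (e 0) with hw
  set h : ℤ → ℂ := mixSeq (qOf e) f (M + 1) with hh
  let v : ℂ⸨X⸩ := ∑ k ∈ Finset.range (M + 1), f k • gaussSeries (e 0 + sOf e - 1) (qOf e) (e 0) k
  have hcoeff : ∀ i, v.coeff i = w i * h i := by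
    intro i
    simp only [v, HahnSeries.coeff_sum, HahnSeries.coeff_smul, gaussSeries_coeff, hh, mixSeq,
      Finset.mul_sum, smul_eq_mul]
    refine Finset.sum_congr rfl fun k _ => ?_
    rw [mul_left_comm]
  refine isReducible_of_series e (e 0) (v := v) ?_ ?_ N hN2 ?_ hN4
  · -- otherwise `w` vanishes somewhere, so `e₁` is an integer and `h` is finite; its last
    -- nonzero term then forces an exponent at infinity to be an integer
    intro hv0
    have hwh : ∀ i, w i * h i = 0 := fun i => by rw [← hcoeff, hv0]; rfl
    classical
    have hfind := Nat.find_spec hfne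
    set k₀ := Nat.find hfne
    have hk₀ : h k₀ ≠ 0 := by
      have hkM : k₀ < M + 1 := by
        by_contra hlt
        exact hfind (hf _ (by omega))
      rw [hh, mixSeq, Finset.sum_eq_single_of_mem k₀ (Finset.mem_range.2 hkM)]
      · rw [sub_self]
        exact mul_ne_zero hfind (binSeq_zero_ne hq')
      · intro k _ hk
        rcases lt_or_gt_of_ne hk with h1 | h1
        · rw [not_not.1 (Nat.find_min hfne h1), zero_mul]
        · rw [binSeq_of_neg _ (by omega), mul_zero]
    have hwk : w k₀ = 0 := (mul_eq_zero.1 (hwh k₀)).resolve_right hk₀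
    obtain ⟨n, hn⟩ : ∃ n : ℕ, e 0 + 1 + (k₀ : ℤ) = -n := by
      by_contra hcon
      push Not at hcon
      exact eulerSeq_ne_zero hp' hcon hwk
    have hlarge : ∀ i : ℤ, (k₀ : ℤ) + n < i → h i = 0 := by
      intro i hi
      refine (mul_eq_zero.1 (hwh i)).resolve_left (eulerSeq_ne_zero hp' fun m hm => ?_)
      have h1 : ((i - k₀ + m - n : ℤ) : ℂ) = 0 := by
        push_cast at hn ⊢
        linear_combination hm - hn
      have h2 : i - k₀ + m - n = 0 := by exact_mod_cast h1
      omega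
    -- the largest index of a nonzero term
    obtain ⟨i, hi, hmax⟩ : ∃ i, h i ≠ 0 ∧ ∀ j, h j ≠ 0 → j ≤ i :=
      Int.exists_greatest_of_bdd ⟨k₀ + n, fun z hz => by
        by_contra hlt
        exact hz (hlarge z (not_le.1 hlt))⟩ ⟨k₀, hk₀⟩
    have hi' : ∀ j, i < j → h j = 0 := fun j hj => by
      by_contra hne
      exact absurd (hmax j hne) (not_le.2 hj)
    have hlast := hmix i
    rw [hi' (i + 1) (by omega), hi' (i + 2) (by omega), hi' (i + 3) (by omega)] at hlast
    simp only [mul_zero, add_zero] at hlast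
    have hb := (mul_eq_zero.1 hlast).resolve_right hi
    have he0 : e 0 = ((-n - 1 - k₀ : ℤ) : ℂ) := by
      push_cast at hn ⊢
      linear_combination hn
    have hcontra : ∀ z : ℂ, ¬ IsInt z → e 0 + i + z ≠ 0 := fun z hz h => hz
      ⟨n + 1 + k₀ - i, by rw [he0] at h; push_cast at h ⊢; linear_combination h⟩
    rw [b0] at hb
    exact (mul_ne_zero (mul_ne_zero (hcontra _ h6) (hcontra _ h7)) (hcontra _ h8)) hb
  · intro m
    have hw1 := eulerSeq_succ hp' (e 0)
    have hstep : ∀ i : ℤ, (e 0 + i + 1) * w (i + 1) = (e 0 + sOf e + i) * w i := by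
      intro i
      obtain ⟨W, h1, h2⟩ := hw1 i
      rw [hw, h1, h2]
      ring
    have s1 := hstep m
    have s2 := hstep (m + 1)
    have s3 := hstep (m + 2)
    rw [show m + 1 + 1 = m + 2 by ring] at s2
    rw [show m + 2 + 1 = m + 3 by ring] at s3
    push_cast at s2 s3
    have t2 : (e 0 + m + 1) * (e 0 + m + 2) * w (m + 2) =
        (e 0 + sOf e + m + 1) * (e 0 + sOf e + m) * w m := by
      linear_combination (e 0 + m + 1) * s2 + (e 0 + sOf e + m + 1) * s1
    have t3 : (e 0 + m + 1) * (e 0 + m + 2) * (e 0 + m + 3) * w (m + 3) =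
        (e 0 + sOf e + m + 2) * (e 0 + sOf e + m + 1) * (e 0 + sOf e + m) * w m := by
      linear_combination (e 0 + m + 1) * (e 0 + m + 2) * s3 + (e 0 + sOf e + m + 2) * t2
    rw [hcoeff, hcoeff, hcoeff, hcoeff]
    linear_combination ((e 0 + sOf e + m + 2) * (e 0 + sOf e + m + 1) * (e 0 + sOf e + m) * w m) *
      hmix m + ((e 0 + m + sOf e + 2) * (e 0 + m + sOf e + 1) * b1 e (e 0 + m) * h (m + 1)) * s1
      + ((e 0 + m + sOf e + 2) * b2 e (e 0 + m) * h (m + 2)) * t2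
      + (b3 e (e 0 + m) * h (m + 3)) * t3
  · refine N.sum_mem fun k _ => ?_
    have h1 := N.smul_mem (algebraMap ℂ K (f k)) (hN3 k)
    rwa [algebraMap_smul] at h1

end Tridiagonal

/-! ### Singular tridiagonal matrices -/

/-- The matrix of `x ^ m ↦ A(m) x ^ (m + 1) + B(m) x ^ m + C(m) x ^ (m - 1)` on polynomials of
degree at most `n` (with the term in `x ^ (n + 1)` dropped). -/
def triMat (A B C : ℂ → ℂ) (n : ℕ) : Matrix (Fin (n + 1)) (Fin (n + 1)) ℂ :=
  fun i j => (if (i : ℕ) = j + 1 then A j else 0) + (if (i : ℕ) = j then B j else 0)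
    + (if (j : ℕ) = i + 1 then C j else 0)

theorem triMat_mulVec (A B C : ℂ → ℂ) {n : ℕ} {F : ℤ → ℂ} (hneg : ∀ k < 0, F k = 0)
    (hlarge : ∀ k : ℤ, n < k → F k = 0) (i : Fin (n + 1)) :
    (triMat A B C n).mulVec (fun j => F (j : ℕ)) i =
      A ((i : ℕ) - 1) * F ((i : ℕ) - 1) + B (i : ℕ) * F (i : ℕ) +
        C ((i : ℕ) + 1) * F ((i : ℕ) + 1) := by
  obtain ⟨i, hi⟩ := i
  have hA : ∑ j ∈ Finset.range (n + 1), (if i = j + 1 then A j else 0) * F j =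
      A (i - 1) * F (i - 1) := by
    cases i with
    | zero => simp [hneg]
    | succ i =>
      simp only [add_left_inj, ite_mul, zero_mul, Finset.sum_ite_eq, Finset.mem_range]
      rw [if_pos (by omega)]
      push_cast
      rw [add_sub_cancel_right, add_sub_cancel_right]
  have hB : ∑ j ∈ Finset.range (n + 1), (if i = j then B j else 0) * F j = B i * F i := by
    simp only [ite_mul, zero_mul, Finset.sum_ite_eq, Finset.mem_range]
    rw [if_pos hi]
  have hC : ∑ j ∈ Finset.range (n + 1), (if j = i + 1 then C j else 0) * F j =
      C (i + 1) * F (i + 1) := by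
    simp only [ite_mul, zero_mul, Finset.sum_ite_eq', Finset.mem_range]
    split_ifs with h
    · push_cast
      rfl
    · rw [hlarge _ (by omega), mul_zero]
  rw [Matrix.mulVec, dotProduct]
  change ∑ j : Fin (n + 1), ((if i = j + 1 then A (j : ℕ) else 0) +
    (if i = j then B (j : ℕ) else 0) + (if (j : ℕ) = i + 1 then C (j : ℕ) else 0)) * F (j : ℕ) = _
  rw [← hA, ← hB, ← hC, ← Finset.sum_add_distrib, ← Finset.sum_add_distrib, Finset.sum_range]
  exact Finset.sum_congr rfl fun j _ => by ring

/-- A kernel vector of the tridiagonal matrix, as a sequence killed by the recurrence. -/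
theorem exists_seq_of_triMat {A B C : ℂ → ℂ} {n : ℕ} (hA : A n = 0)
    {g : Fin (n + 1) → ℂ} (hg : g ≠ 0) (hM : (triMat A B C n).mulVec g = 0) :
    ∃ f : ℕ → ℂ, (∀ k, n + 1 ≤ k → f k = 0) ∧ (∃ k, f k ≠ 0) ∧ B 0 * f 0 + C 1 * f 1 = 0 ∧
      ∀ k : ℕ, A k * f k + B (k + 1) * f (k + 1) + C (k + 2) * f (k + 2) = 0 := by
  let F : ℤ → ℂ := fun k => if h : 0 ≤ k ∧ k ≤ n then g ⟨k.toNat, by omega⟩ else 0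
  have hF : g = fun i : Fin (n + 1) => F (i : ℕ) := by
    funext i
    simp only [F]
    rw [dif_pos (by omega)]
    rfl
  have hneg : ∀ k < 0, F k = 0 := fun k hk => dif_neg (by omega)
  have hlarge : ∀ k : ℤ, n < k → F k = 0 := fun k hk => dif_neg (by omega)
  have hrow : ∀ i : ℕ, i < n + 1 →
      A (i - 1) * F (i - 1) + B i * F i + C (i + 1) * F (i + 1) = 0 := by
    intro i hi
    rw [hF] at hM
    rw [← triMat_mulVec A B C hneg hlarge ⟨i, hi⟩, hM]
    rfl
  refine ⟨fun k => F k, fun k hk => hlarge _ (by omega), ?_, ?_, fun k => ?_⟩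
  · by_contra hcon
    push Not at hcon
    exact hg (hF.trans (funext fun i => hcon i))
  · have h := hrow 0 (by omega)
    simpa [hneg] using h
  · dsimp only
    rcases lt_trichotomy k n with hk | rfl | hk
    · have h := hrow (k + 1) (by omega)
      push_cast at h ⊢
      rw [← h]
      ring_nf
    · rw [hA, hlarge (k + 1 : ℕ) (by omega), hlarge (k + 2 : ℕ) (by omega)]
      ring
    · rw [hlarge k (by omega), hlarge (k + 1 : ℕ) (by omega), hlarge (k + 2 : ℕ) (by omega)]
      ring

/-- A tridiagonal operator on polynomials of even degree `n` is singular if it is antisymmetric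
for the `𝔰𝔩₂`-invariant symmetric form `⟨x ^ m, x ^ (n - m)⟩ = (-1) ^ m m! (n - m)!`, as the
dimension `n + 1` is odd. -/
theorem exists_ker_of_antisymm {A B C : ℂ → ℂ} {n : ℕ} (hn : Even n)
    (hA : ∀ m, A m * (m + 1) = A (n - 1 - m) * (n - m)) (hB : ∀ m, B m + B (n - m) = 0)
    (hC : ∀ m, C m * (n - m + 1) = C (n - m + 1) * m) :
    ∃ g : Fin (n + 1) → ℂ, g ≠ 0 ∧ (triMat A B C n).mulVec g = 0 := by
  let J : ℕ → ℂ := fun a => (-1) ^ a * (a.factorial * (n - a).factorial)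
  have hJ : ∀ a, J a ≠ 0 := fun a => mul_ne_zero (pow_ne_zero _ (by norm_num))
    (mul_ne_zero (by exact_mod_cast a.factorial_ne_zero)
      (by exact_mod_cast (n - a).factorial_ne_zero))
  let S : Matrix (Fin (n + 1)) (Fin (n + 1)) ℂ := fun a b => J a * triMat A B C n a.rev b
  have hS : S.transpose = -S := by
    ext b a
    change J a * triMat A B C n a.rev b = -(J b * triMat A B C n b.rev a)
    have ha := a.2
    have hb := b.2
    have hra : (a.rev : ℕ) = n - a := by rw [Fin.val_rev]; omega
    have hrb : (b.rev : ℕ) = n - b := by rw [Fin.val_rev]; omega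
    simp only [triMat, hra, hrb]
    by_cases h1 : (a : ℕ) + b + 1 = n
    · rw [if_pos (by omega), if_neg (by omega), if_neg (by omega), if_pos (by omega),
        if_neg (by omega), if_neg (by omega)]
      have hAa := hA b
      have hc : (n : ℂ) = a + b + 1 := by exact_mod_cast h1.symm
      rw [show (n : ℂ) - 1 - (b : ℕ) = (a : ℕ) by rw [hc]; ring,
        show (n : ℂ) - (b : ℕ) = (a : ℕ) + 1 by rw [hc]; ring] at hAa
      have hsign : (-1 : ℂ) ^ (a : ℕ) = -(-1) ^ (b : ℕ) := by
        have h2 : (-1 : ℂ) ^ (a + b + 1 : ℕ) = 1 := by rw [h1]; exact hn.neg_one_pow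
        have h3 : (-1 : ℂ) ^ (b : ℕ) * (-1) ^ (b : ℕ) = 1 := by
          rw [← mul_pow]; norm_num
        rw [pow_succ, pow_add] at h2
        linear_combination (-(-1 : ℂ) ^ (b : ℕ)) * h2 - (-1 : ℂ) ^ (a : ℕ) * h3
      simp only [J]
      rw [show n - (a : ℕ) = b + 1 by omega, show n - (b : ℕ) = a + 1 by omega,
        Nat.factorial_succ, Nat.factorial_succ, hsign]
      push_cast
      linear_combination (-(-1 : ℂ) ^ (b : ℕ) * (a : ℕ).factorial * (b : ℕ).factorial) * hAa
    by_cases h2 : (a : ℕ) + b = n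
    · rw [if_neg (by omega), if_pos (by omega), if_neg (by omega), if_neg (by omega),
        if_pos (by omega), if_neg (by omega)]
      have hBa := hB b
      have hc : (n : ℂ) = a + b := by exact_mod_cast h2.symm
      rw [show (n : ℂ) - (b : ℕ) = (a : ℕ) by rw [hc]; ring] at hBa
      have hsign : (-1 : ℂ) ^ (a : ℕ) = (-1) ^ (b : ℕ) := by
        have h2 : (-1 : ℂ) ^ (a + b : ℕ) = 1 := by rw [h2]; exact hn.neg_one_pow
        have h3 : (-1 : ℂ) ^ (b : ℕ) * (-1) ^ (b : ℕ) = 1 := by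
          rw [← mul_pow]; norm_num
        rw [pow_add] at h2
        linear_combination ((-1 : ℂ) ^ (b : ℕ)) * h2 - (-1 : ℂ) ^ (a : ℕ) * h3
      simp only [J]
      rw [show n - (a : ℕ) = b by omega, show n - (b : ℕ) = a by omega, hsign]
      linear_combination ((-1 : ℂ) ^ (b : ℕ) * (a : ℕ).factorial * (b : ℕ).factorial) * hBa
    by_cases h3 : (a : ℕ) + b = n + 1
    · rw [if_neg (by omega), if_neg (by omega), if_pos (by omega), if_neg (by omega),
        if_neg (by omega), if_pos (by omega)]
      have hCa := hC b
      obtain ⟨a', ha'⟩ : ∃ a', (a : ℕ) = a' + 1 := ⟨a - 1, by omega⟩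
      obtain ⟨b', hb'⟩ : ∃ b', (b : ℕ) = b' + 1 := ⟨b - 1, by omega⟩
      have hc : (n : ℂ) = a + b - 1 := by
        rw [eq_sub_iff_add_eq]; exact_mod_cast h3.symm
      rw [show (n : ℂ) - (b : ℕ) + 1 = (a : ℕ) by rw [hc]; ring] at hCa
      have hsign : (-1 : ℂ) ^ (a : ℕ) = -(-1) ^ (b : ℕ) := by
        have h2 : (-1 : ℂ) ^ (a + b : ℕ) = -1 := by rw [h3]; exact hn.add_one.neg_one_pow
        have h3 : (-1 : ℂ) ^ (b : ℕ) * (-1) ^ (b : ℕ) = 1 := by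
          rw [← mul_pow]; norm_num
        rw [pow_add] at h2
        linear_combination ((-1 : ℂ) ^ (b : ℕ)) * h2 - (-1 : ℂ) ^ (a : ℕ) * h3
      simp only [J]
      rw [show n - (a : ℕ) = b' by omega, show n - (b : ℕ) = a' by omega, hsign]
      rw [ha', hb'] at hCa ⊢
      rw [Nat.factorial_succ, Nat.factorial_succ]
      push_cast at hCa ⊢
      linear_combination (-(-1 : ℂ) ^ (b' + 1) * a'.factorial * b'.factorial) * hCa
    · rw [if_neg (by omega), if_neg (by omega), if_neg (by omega), if_neg (by omega),
        if_neg (by omega), if_neg (by omega)]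
      ring
  have hdet : S.det = 0 := by
    have h := congrArg Matrix.det hS
    rw [Matrix.det_transpose, Matrix.det_neg, Fintype.card_fin, hn.add_one.neg_one_pow] at h
    linear_combination h / 2
  obtain ⟨g, hg, hSg⟩ := Matrix.exists_mulVec_eq_zero_iff.2 hdet
  refine ⟨g, hg, funext fun i => ?_⟩
  have h := congrFun hSg i.rev
  have h2 : S.mulVec g i.rev = J i.rev * (triMat A B C n).mulVec g i := by
    simp only [Matrix.mulVec, dotProduct, Finset.mul_sum, S, Fin.rev_rev, mul_assoc]
  rw [h2] at h
  exact (mul_eq_zero.1 h).resolve_left (hJ _)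

/-! ### Jacobi polynomials and a singular tridiagonal family -/

section Jacobi

variable (α κ : ℂ)

/-- Eigenvalues of the Jacobi operator `jacG`. -/
def jacEigen (m : ℂ) : ℂ := m * (m + κ)

/-- The hypergeometric operator `θ (θ + κ) - ∂ (θ - α)`, whose polynomial eigenvectors are the Jacobi
polynomials, on coefficient sequences. -/
def jacG (f : ℤ → ℂ) (m : ℤ) : ℂ :=
  jacEigen κ m * f m - (m + 1) * (m + 1 - α) * f (m + 1)

/-- The operator `x (2 θ + 1 + κ) - (2 θ + 1 - α)` on coefficient sequences; it is the commutator of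
`jacG` with the multiplication by `x`. -/
def jacX (f : ℤ → ℂ) (m : ℤ) : ℂ :=
  (2 * m - 1 + κ) * f (m - 1) - (2 * m + 1 - α) * f m

/-- The monic Jacobi polynomial of degree `m`, as a sequence of coefficients. For `m < 0` this is a
series in `1 / x`; the factor `i + 1` makes the coefficients of negative index vanish for `m ≥ 0`. -/
def jacP (m j : ℤ) : ℂ :=
  if j ≤ m then ∏ i ∈ Finset.Ico j m, (i + 1) * (i + 1 - α) / (jacEigen κ i - jacEigen κ m) else 0

theorem jacP_self (m : ℤ) : jacP α κ m m = 1 := by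
  simp [jacP]

theorem jacP_of_lt {m j : ℤ} (h : m < j) : jacP α κ m j = 0 := if_neg (not_le.2 h)

theorem jacP_of_neg {m j : ℤ} (hm : 0 ≤ m) (hj : j < 0) : jacP α κ m j = 0 := by
  rw [jacP, if_pos (by omega)]
  refine Finset.prod_eq_zero (i := -1) (Finset.mem_Ico.2 ⟨by omega, by omega⟩) ?_
  simp

variable {α κ}

theorem jacEigen_ne (hκ : ¬ IsInt κ) {i j : ℤ} (h : i ≠ j) : jacEigen κ i ≠ jacEigen κ j := by
  intro heq
  have h1 : ((i : ℂ) - j) * (i + j + κ) = 0 := by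
    simp only [jacEigen] at heq
    linear_combination heq
  rcases mul_eq_zero.1 h1 with h2 | h2
  · exact h (by exact_mod_cast sub_eq_zero.1 h2)
  · exact hκ ⟨-i - j, by push_cast; linear_combination h2⟩

theorem jacG_jacP (hκ : ¬ IsInt κ) (m j : ℤ) :
    jacG α κ (jacP α κ m) j = jacEigen κ m * jacP α κ m j := by
  rcases lt_trichotomy j m with h | rfl | h
  · have hne := sub_ne_zero.2 (jacEigen_ne hκ h.ne)
    have h1 : jacP α κ m j = (j + 1) * (j + 1 - α) / (jacEigen κ j - jacEigen κ m) *
        jacP α κ m (j + 1) := by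
      rw [jacP, jacP, if_pos h.le, if_pos (by omega), ← Finset.insert_Ico_add_one_left_eq_Ico h,
        Finset.prod_insert (by simp)]
    rw [div_mul_eq_mul_div, eq_div_iff hne] at h1
    rw [jacG]
    linear_combination h1
  · rw [jacG, jacP_of_lt _ _ (by omega : j < j + 1)]
    ring
  · rw [jacG, jacP_of_lt _ _ h, jacP_of_lt _ _ (by omega : m < j + 1)]
    ring

/-- Eigenvectors of the Jacobi operator are determined by one coefficient. -/
theorem eq_zero_of_jacG (hκ : ¬ IsInt κ) {N t : ℤ} {F : ℤ → ℂ} (hF : ∀ j, N < j → F j = 0)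
    (hG : ∀ j, jacG α κ F j = jacEigen κ t * F j) (ht : F t = 0) (j : ℤ) : F j = 0 := by
  have h : ∀ d : ℕ, ∀ j, N - d < j → F j = 0 := by
    intro d
    induction d with
    | zero => intro j hj; exact hF j (by simpa using hj)
    | succ d ih =>
      intro j hj
      by_cases hjt : j = t
      · rw [hjt, ht]
      have h1 := hG j
      rw [jacG, ih (j + 1) (by push_cast at hj; omega)] at h1
      refine (mul_eq_zero.1 (?_ : (jacEigen κ j - jacEigen κ t) * F j = 0)).resolve_left
        (sub_ne_zero.2 (jacEigen_ne hκ hjt))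
      linear_combination h1
  exact h (N - j + 1).toNat j (by omega)

/-- The double commutator of the two operators. -/
theorem jacG_jacG_jacX (F : ℤ → ℂ) (j : ℤ) :
    jacG α κ (jacG α κ (jacX α κ F)) j - 2 * jacG α κ (jacX α κ (jacG α κ F)) j
      + jacX α κ (jacG α κ (jacG α κ F)) j =
    2 * (jacG α κ (jacX α κ F) j + jacX α κ (jacG α κ F) j) - (1 - κ ^ 2) * jacX α κ F j := by
  simp only [jacG, jacX, jacEigen, add_sub_cancel_right, sub_add_cancel]
  push_cast
  ring

/-- On the image under `jacX` of an eigenvector, `jacG` has only the two neighbouring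
eigenvalues. -/
theorem jacG_jacX {F : ℤ → ℂ} {m : ℂ} (hG : ∀ j, jacG α κ F j = jacEigen κ m * F j) (j : ℤ) :
    jacG α κ (jacG α κ (jacX α κ F)) j =
      (jacEigen κ (m + 1) + jacEigen κ (m - 1)) * jacG α κ (jacX α κ F) j
        - jacEigen κ (m + 1) * jacEigen κ (m - 1) * jacX α κ F j := by
  have h1 : jacG α κ F = fun j => jacEigen κ m * F j := funext hG
  have hG' : ∀ (l : ℂ) (E : ℤ → ℂ), jacG α κ (fun j => l * E j) = fun j => l * jacG α κ E j :=
    fun l E => funext fun j => by simp only [jacG]; ring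
  have hX' : ∀ (l : ℂ) (E : ℤ → ℂ), jacX α κ (fun j => l * E j) = fun j => l * jacX α κ E j :=
    fun l E => funext fun j => by simp only [jacX]; ring
  have h := jacG_jacG_jacX (α := α) (κ := κ) F j
  rw [h1, hX', hG', hG', h1, hX', hX'] at h
  rw [show jacEigen κ (m + 1) = jacEigen κ m + 2 * m + 1 + κ by simp only [jacEigen]; ring,
    show jacEigen κ (m - 1) = jacEigen κ m - 2 * m + 1 - κ by simp only [jacEigen]; ring]
  have hm : jacEigen κ m = m * (m + κ) := rfl
  linear_combination h + 4 * jacX α κ F j * hm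

/-- The operator `jacX` maps each Jacobi polynomial to a combination of its two neighbours. -/
theorem exists_jacX_jacP (hκ : ¬ IsInt κ) (m : ℤ) : ∃ d : ℂ, ∀ j,
    jacX α κ (jacP α κ m) j =
      (2 * m + 1 + κ) * jacP α κ (m + 1) j + d * jacP α κ (m - 1) j := by
  let F : ℤ → ℂ := fun j => jacX α κ (jacP α κ m) j - (2 * m + 1 + κ) * jacP α κ (m + 1) j
  let H : ℤ → ℂ := fun j => jacG α κ F j - jacEigen κ (m + 1 : ℤ) * F j
  have hF : ∀ j, m < j → F j = 0 := by
    intro j hj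
    simp only [F, jacX]
    rw [jacP_of_lt _ _ hj]
    rcases eq_or_ne j (m + 1) with rfl | h
    · rw [jacP_self, show m + 1 - 1 = m by ring, jacP_self]
      push_cast
      ring
    · rw [jacP_of_lt _ _ (by omega : m < j - 1), jacP_of_lt _ _ (by omega : m + 1 < j)]
      ring
  have hH : ∀ j, m < j → H j = 0 := by
    intro j hj
    simp only [H, jacG]
    rw [hF j hj, hF (j + 1) (by omega)]
    ring
  have hGH : ∀ j, jacG α κ H j = jacEigen κ (m - 1 : ℤ) * H j := by
    intro j
    have h1 := jacG_jacX (jacG_jacP (α := α) hκ m) j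
    have h2 := jacG_jacP (α := α) hκ (m + 1) j
    have h3 := jacG_jacP (α := α) hκ (m + 1) (j + 1)
    simp only [H, F, jacG] at h1 h2 h3 ⊢
    push_cast at h1 h2 h3 ⊢
    linear_combination h1 - (2 * m + 1 + κ) * (jacEigen κ j - jacEigen κ (m - 1)) * h2
      + (2 * m + 1 + κ) * ((j + 1) * (j + 1 - α)) * h3
  have hH' : ∀ j, H j = H (m - 1) * jacP α κ (m - 1) j := by
    intro j
    refine sub_eq_zero.1 (eq_zero_of_jacG (α := α) hκ (N := m) (t := m - 1)
      (F := fun j => H j - H (m - 1) * jacP α κ (m - 1) j) ?_ ?_ ?_ j)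
    · intro j hj
      rw [hH j hj, jacP_of_lt _ _ (by omega)]
      ring
    · intro j
      have h1 := hGH j
      have h2 := jacG_jacP (α := α) hκ (m - 1) j
      simp only [jacG] at h1 h2 ⊢
      linear_combination h1 - H (m - 1) * h2
    · simp only [jacP_self]
      ring
  have hne := sub_ne_zero.2 (jacEigen_ne hκ (by omega : m - 1 ≠ m + 1))
  refine ⟨H (m - 1) / (jacEigen κ (m - 1 : ℤ) - jacEigen κ (m + 1 : ℤ)), fun j => ?_⟩
  set d := H (m - 1) / (jacEigen κ (m - 1 : ℤ) - jacEigen κ (m + 1 : ℤ)) with hd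
  rw [eq_div_iff hne] at hd
  have key := eq_zero_of_jacG (α := α) hκ (N := m) (t := m + 1)
    (F := fun j => F j - d * jacP α κ (m - 1) j) ?_ ?_ ?_ j
  · simp only [F] at key
    linear_combination key
  · intro j hj
    rw [hF j hj, jacP_of_lt _ _ (by omega)]
    ring
  · intro j
    have h1 := hH' j
    have h2 := jacG_jacP (α := α) hκ (m - 1) j
    simp only [H, jacG] at h1 h2 hd ⊢
    linear_combination h1 - d * h2 + jacP α κ (m - 1) j * (-hd)
  · rw [hF _ (by omega), jacP_of_lt _ _ (by omega)]
    ring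

/-- `k` bidiagonal equations in `k + 1` unknowns have a nonzero solution. -/
theorem exists_ker_of_bidiagonal (a b : ℕ → ℂ) (k : ℕ) :
    ∃ c : ℕ → ℂ, (∃ j ≤ k, c j ≠ 0) ∧ ∀ j < k, a j * c j + b j * c (j + 1) = 0 := by
  induction k with
  | zero => exact ⟨1, ⟨0, le_rfl, one_ne_zero⟩, fun j hj => absurd hj (Nat.not_lt_zero j)⟩
  | succ k ih =>
    obtain ⟨c, ⟨j₀, hj₀, hc⟩, h⟩ := ih
    by_cases hb : b k = 0
    · refine ⟨fun j => if j = k + 1 then 1 else 0, ⟨k + 1, le_rfl, by simp⟩, fun j hj => ?_⟩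
      dsimp only
      rw [if_neg (by omega)]
      rcases eq_or_ne j k with rfl | hjk
      · rw [hb]; ring
      · rw [if_neg (by omega)]; ring
    · refine ⟨fun j => if j = k + 1 then -a k * c k / b k else c j, ⟨j₀, by omega, ?_⟩,
        fun j hj => ?_⟩
      · dsimp only
        rwa [if_neg (by omega)]
      · dsimp only
        rw [if_neg (by omega)]
        rcases eq_or_ne j k with rfl | hjk
        · rw [if_pos rfl]
          field_simp
          ring
        · rw [if_neg (by omega)]
          exact h j (by omega)

/-- Coefficient of `x ^ (m + 1)` in the image of `x ^ m` under `u X G + v G X + w X`, where `G` and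
`X` are the operators `jacG` and `jacX`. -/
def jacA (κ u v w m : ℂ) : ℂ :=
  (2 * m + 1 + κ) * (u * jacEigen κ m + v * jacEigen κ (m + 1) + w)

/-- Coefficient of `x ^ m` in the image of `x ^ m` under `u X G + v G X + w X`. -/
def jacB (α κ u v w m : ℂ) : ℂ :=
  -(2 * m + 1 - α) * ((u + v) * jacEigen κ m + w) - u * (m * (m - α)) * (2 * m - 1 + κ)
    - v * (2 * m + 1 + κ) * ((m + 1) * (m + 1 - α))

/-- Coefficient of `x ^ (m - 1)` in the image of `x ^ m` under `u X G + v G X + w X`. -/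
def jacC (α u v m : ℂ) : ℂ :=
  u * (m * (m - α)) * (2 * m - 1 - α) + v * (2 * m + 1 - α) * (m * (m - α))

/-- The operator `u X G + v G X + w X` on coefficient sequences. -/
def jacM (α κ u v w : ℂ) (f : ℤ → ℂ) (m : ℤ) : ℂ :=
  jacA κ u v w (m - 1) * f (m - 1) + jacB α κ u v w m * f m + jacC α u v (m + 1) * f (m + 1)

theorem jacM_eq (u v w : ℂ) (f : ℤ → ℂ) (m : ℤ) :
    jacM α κ u v w f m = u * jacX α κ (jacG α κ f) m + v * jacG α κ (jacX α κ f) m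
      + w * jacX α κ f m := by
  simp only [jacM, jacA, jacB, jacC, jacG, jacX, jacEigen, add_sub_cancel_right, sub_add_cancel]
  push_cast
  ring

/-- The operator `u X G + v G X + w X` maps each Jacobi polynomial to a combination of its two
neighbours. -/
theorem exists_jacM_jacP (hκ : ¬ IsInt κ) (u v w : ℂ) (m : ℤ) : ∃ d : ℂ, ∀ j,
    jacM α κ u v w (jacP α κ m) j =
      jacA κ u v w m * jacP α κ (m + 1) j + d * jacP α κ (m - 1) j := by
  obtain ⟨d, hd⟩ := exists_jacX_jacP (α := α) hκ m
  refine ⟨(u * jacEigen κ m + v * jacEigen κ (m - 1) + w) * d, fun j => ?_⟩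
  have h1 : jacG α κ (jacP α κ m) = fun j => jacEigen κ m * jacP α κ m j :=
    funext (jacG_jacP hκ m)
  have h2 := hd j
  have h3 : jacG α κ (jacX α κ (jacP α κ m)) j =
      (2 * m + 1 + κ) * (jacEigen κ (m + 1) * jacP α κ (m + 1) j)
        + d * (jacEigen κ (m - 1) * jacP α κ (m - 1) j) := by
    have h4 := jacG_jacP (α := α) hκ (m + 1) j
    have h5 := jacG_jacP (α := α) hκ (m - 1) j
    push_cast at h4 h5
    rw [← h4, ← h5, jacG, hd, hd, jacG, jacG]
    ring
  have h6 : jacX α κ (fun j => jacEigen κ m * jacP α κ m j) j =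
      jacEigen κ m * jacX α κ (jacP α κ m) j := by
    simp only [jacX]
    ring
  rw [jacM_eq, h1, h6, h3, h2, jacA]
  ring

/-- The operator `u X G + v G X + w X` exchanges even and odd Jacobi polynomials. If it preserves
the polynomials of degree at most `2 k`, it is singular there, as there are `k + 1` even and `k` odd
Jacobi polynomials in that range. -/
theorem det_jac_eq_zero_of_not_isInt (hκ : ¬ IsInt κ) {u v w : ℂ} {k : ℕ}
    (hA : jacA κ u v w (2 * k : ℕ) = 0) :
    (triMat (jacA κ u v w) (jacB α κ u v w) (jacC α u v) (2 * k)).det = 0 := by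
  choose d hd using fun m : ℤ => exists_jacM_jacP (α := α) hκ u v w m
  obtain ⟨c, hc, hrec⟩ := exists_ker_of_bidiagonal (fun j => jacA κ u v w (2 * j : ℕ))
    (fun j => d (2 * (j + 1) : ℕ)) k
  -- the lower neighbour of the constant polynomial does not contribute: compare the coefficients
  -- of index `-1`
  have hd0 : d 0 = 0 := by
    have h := hd 0 (-1)
    have hneg : ∀ j < 0, jacP α κ 0 j = 0 := fun j => jacP_of_neg α κ le_rfl
    rw [jacM_eq, jacP_of_neg α κ (by omega : (0 : ℤ) ≤ 0 + 1) (by omega), zero_sub, jacP_self] at h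
    simp only [jacG, jacX, hneg _ (by norm_num : (-1 : ℤ) < 0),
      hneg _ (by norm_num : (-1 : ℤ) - 1 < 0), sub_add_cancel] at h
    push_cast at h
    linear_combination -h
  let F : ℕ → ℤ → ℂ := fun K i => ∑ j ∈ Finset.range K, c j * jacP α κ (2 * j : ℕ) i
  have hFneg : ∀ K, ∀ i < 0, F K i = 0 := fun K i hi => Finset.sum_eq_zero fun j _ => by
    rw [jacP_of_neg α κ (by omega) hi, mul_zero]
  have hFlarge : ∀ K (i : ℤ), (2 * K : ℕ) ≤ i + 1 → F K i = 0 := fun K i hi =>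
    Finset.sum_eq_zero fun j hj => by
      have := Finset.mem_range.1 hj
      rw [jacP_of_lt α κ (by omega), mul_zero]
  have hFne : ∀ K, (∀ i, F K i = 0) → ∀ j < K, c j = 0 := by
    intro K
    induction K with
    | zero => intro _ j hj; omega
    | succ K ih =>
      intro h j hj
      have hK : c K = 0 := by
        have h1 := h (2 * K : ℕ)
        have h2 := hFlarge K (2 * K : ℕ) (by omega)
        simp only [F] at h1 h2
        rwa [Finset.sum_range_succ, h2, jacP_self, zero_add, mul_one] at h1
      rcases Nat.lt_succ_iff_lt_or_eq.1 hj with hj' | rfl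
      · refine ih (fun i => ?_) j hj'
        have h1 := h i
        simp only [F] at h1 ⊢
        rwa [Finset.sum_range_succ, hK, zero_mul, add_zero] at h1
      · exact hK
  have hadd : ∀ K i, jacM α κ u v w (F (K + 1)) i = jacM α κ u v w (F K) i
      + c K * jacM α κ u v w (jacP α κ (2 * K : ℕ)) i := by
    intro K i
    simp only [jacM, F, Finset.sum_range_succ]
    ring
  -- the coefficients of the odd Jacobi polynomials cancel successively
  have hM : ∀ K ≤ k, ∀ i, jacM α κ u v w (F (K + 1)) i =
      c K * jacA κ u v w (2 * K : ℕ) * jacP α κ ((2 * K : ℕ) + 1) i := by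
    intro K
    induction K with
    | zero =>
      intro _ i
      have h0 : jacM α κ u v w (F 0) i = 0 := by simp [jacM, F]
      rw [hadd, h0, hd]
      simp only [mul_zero, Nat.cast_zero, hd0]
      push_cast
      ring
    | succ K ih =>
      intro hK i
      have h1 := hrec K (by omega)
      rw [hadd, ih (by omega), hd,
        show ((2 * (K + 1) : ℕ) : ℤ) - 1 = (2 * K : ℕ) + 1 by push_cast; ring]
      rw [Int.cast_natCast]
      linear_combination jacP α κ ((2 * K : ℕ) + 1) i * h1
  refine Matrix.exists_mulVec_eq_zero_iff.1 ⟨fun i => F (k + 1) (i : ℕ), fun h0 => ?_, ?_⟩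
  · obtain ⟨j, hj, hcj⟩ := hc
    refine hcj (hFne (k + 1) (fun i => ?_) j (by omega))
    by_cases hi : 0 ≤ i ∧ i < (2 * k + 1 : ℕ)
    · have h := congrFun h0 ⟨i.toNat, by omega⟩
      simpa [Int.toNat_of_nonneg hi.1] using h
    · rcases lt_or_ge i 0 with hi' | hi'
      · exact hFneg _ i hi'
      · exact hFlarge _ i (by omega)
  · funext i
    rw [triMat_mulVec _ _ _ (hFneg _) fun i hi => hFlarge _ i (by omega)]
    have h := hM k le_rfl (i : ℕ)
    rw [jacM, hA] at h
    rw [Int.cast_natCast] at h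
    rw [h]
    simp

/-- For this value of `w`, the operator `u X G + v G X + w X` preserves the polynomials of degree at
most `2 k`. It is singular there for `κ ∉ ℤ`, hence for all `κ` by continuity of the determinant. -/
theorem exists_ker_jac (α κ u v : ℂ) (k : ℕ) : ∃ g : Fin (2 * k + 1) → ℂ, g ≠ 0 ∧
    (triMat (jacA κ u v (-(u * jacEigen κ (2 * k : ℕ) + v * jacEigen κ ((2 * k : ℕ) + 1))))
      (jacB α κ u v (-(u * jacEigen κ (2 * k : ℕ) + v * jacEigen κ ((2 * k : ℕ) + 1))))
      (jacC α u v) (2 * k)).mulVec g = 0 := by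
  refine Matrix.exists_mulVec_eq_zero_iff.2 ?_
  have hdense : Dense {κ : ℂ | ¬ IsInt κ} := by
    have h := (Set.countable_range (fun n : ℤ => (n : ℂ))).dense_compl ℝ
    refine h.mono fun z hz hz' => ?_
    obtain ⟨n, hn⟩ := hz'
    exact hz ⟨n, hn.symm⟩
  refine congrFun (Continuous.ext_on (f := fun κ => (triMat
    (jacA κ u v (-(u * jacEigen κ (2 * k : ℕ) + v * jacEigen κ ((2 * k : ℕ) + 1))))
    (jacB α κ u v (-(u * jacEigen κ (2 * k : ℕ) + v * jacEigen κ ((2 * k : ℕ) + 1))))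
    (jacC α u v) (2 * k)).det) (g := fun _ => 0) hdense ?_ continuous_const fun κ hκ => ?_) κ
  · refine Continuous.matrix_det (continuous_matrix fun i j => ?_)
    simp only [triMat, jacA, jacB, jacC, jacEigen]
    split_ifs <;> fun_prop
  · refine det_jac_eq_zero_of_not_isInt hκ ?_
    rw [jacA]
    ring

end Jacobi

/-! ### Even sums of exponents -/

section Even

/-- The elementary symmetric functions of three numbers are determined by their power sums. -/
theorem sym_congr {a b c a' b' c' : ℂ}
    (h : ∀ N : ℕ, a' ^ N + b' ^ N + c' ^ N = a ^ N + b ^ N + c ^ N) :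
    sym1 a' b' c' = sym1 a b c ∧ sym2 a' b' c' = sym2 a b c ∧ sym3 a' b' c' = sym3 a b c := by
  have h1 := h 1
  have h2 := h 2
  have h3 := h 3
  simp only [pow_one] at h1
  have e2 : a' * b' + a' * c' + b' * c' = a * b + a * c + b * c := by
    linear_combination (a' + b' + c' + a + b + c) / 2 * h1 - h2 / 2
  simp only [sym1, sym2, sym3]
  refine ⟨h1, e2, ?_⟩
  -- Newton's identity `p₃ = s₁ p₂ - s₂ p₁ + 3 s₃`
  linear_combination h3 / 3 - (a' ^ 2 + b' ^ 2 + c' ^ 2) / 3 * h1 - (a + b + c) / 3 * h2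
    + (a' + b' + c') / 3 * e2 + (a * b + a * c + b * c) / 3 * h1

/-- `E₆` is symmetric in the exponents at each singular point. -/
theorem E6v_comp_perm (e : Fin 9 → ℂ) {σ : Equiv.Perm (Fin 9)}
    (hσ : ∀ i, (σ i).val / 3 = i.val / 3) :
    sOf (e ∘ σ) = sOf e ∧ E6v (e ∘ σ) = E6v e := by
  have hsum : ∀ k N : ℕ, ∑ i : Fin 9, (if i.val / 3 = k then e (σ i) ^ N else 0) =
      ∑ i : Fin 9, (if i.val / 3 = k then e i ^ N else 0) := by
    intro k N
    rw [← Equiv.sum_comp σ fun i => if i.val / 3 = k then e i ^ N else 0]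
    exact Finset.sum_congr rfl fun i _ => by rw [hσ]
  obtain ⟨h1, h2, h3⟩ := sym_congr (a := e 0) (b := e 1) (c := e 2) (a' := e (σ 0))
    (b' := e (σ 1)) (c' := e (σ 2)) fun N => by
      simpa [Fin.sum_univ_succ, add_assoc] using hsum 0 N
  obtain ⟨h4, h5, h6⟩ := sym_congr (a := e 3) (b := e 4) (c := e 5) (a' := e (σ 3))
    (b' := e (σ 4)) (c' := e (σ 5)) fun N => by
      simpa [Fin.sum_univ_succ, add_assoc] using hsum 1 N
  obtain ⟨h7, h8, h9⟩ := sym_congr (a := e 6) (b := e 7) (c := e 8) (a' := e (σ 6))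
    (b' := e (σ 7)) (c' := e (σ 8)) fun N => by
      simpa [Fin.sum_univ_succ, add_assoc] using hsum 2 N
  have hs : sOf (e ∘ σ) = sOf e := by
    simp only [sOf, Function.comp_apply, h1, h4, h7]
  refine ⟨hs, ?_⟩
  rw [E6v_eq, E6v_eq]
  simp only [e6Coeff, hs, Function.comp_apply, h1, h2, h3, h4, h5, h6, h7, h8, h9]

/-- Under the condition `hn` the reduced operator preserves the polynomials of degree at most `n`. If
it is singular there, `E₆` is reducible: the resonant cases excluded in `isReducible_of_tri` are those
of an integral exponent. -/
theorem isReducible_of_triMat {e : Fin 9 → ℂ} {n : ℕ} (hn : e 0 + e 3 + e 6 + sOf e - 1 = -n)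
    (hker : ∃ g : Fin (n + 1) → ℂ, g ≠ 0 ∧
      (triMat (triA e) (triB e) (triC e) n).mulVec g = 0) : IsReducible (E6v e) := by
  by_cases h0 : IsInt (e 0 + sOf e)
  · exact isReducible_of_isInt_zero e h0
  by_cases h3 : IsInt (e 3 + sOf e)
  · refine isReducible_of_swapExp (isReducible_of_isInt_zero _ ?_)
    rwa [sOf_swapExp]
  by_cases h6 : IsInt (e 6)
  · exact isReducible_of_isInt_infty e (Or.inr (Or.inl h6))
  by_cases h7 : IsInt (e 7)
  · exact isReducible_of_isInt_infty e (Or.inr (Or.inr (Or.inl h7)))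
  by_cases h8 : IsInt (e 8)
  · exact isReducible_of_isInt_infty e (Or.inr (Or.inr (Or.inr h8)))
  obtain ⟨g, hg, hM⟩ := hker
  have hA : triA e n = 0 := by
    rw [triA, b0, show e 0 + qOf e + (n : ℂ) + e 6 = 0 by rw [qOf]; linear_combination hn]
    ring
  obtain ⟨f, hf, hfne, hf0, hrec⟩ := exists_seq_of_triMat hA hg hM
  refine isReducible_of_tri h0 h3 (fun ⟨m, hm⟩ => h6 ⟨1 - n - m, ?_⟩) h6 h7 h8 hf hfne hf0 hrec
  push_cast
  linear_combination hn - hm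

theorem triMat_mul (c : ℂ) (A B C : ℂ → ℂ) (n : ℕ) :
    triMat (fun m => c * A m) (fun m => c * B m) (fun m => c * C m) n = c • triMat A B C n := by
  ext i j
  simp only [triMat, Matrix.smul_apply, smul_eq_mul]
  split_ifs <;> ring

/-- If the sum of three extreme exponents is a nonpositive even integer, the reduced operator is a
member of the Jacobi family. -/
theorem isReducible_of_extreme_neg {e : Fin 9 → ℂ} {g : ℂ} (h0 : e 0 - 2 * e 1 + e 2 = g)
    (h1 : e 3 - 2 * e 4 + e 5 = g) (h2 : e 6 - 2 * e 7 + e 8 = g) {k : ℕ}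
    (hk : e 0 + e 3 + e 6 + sOf e - 1 = -(2 * k : ℕ)) : IsReducible (E6v e) := by
  refine isReducible_of_triMat hk ?_
  obtain ⟨f, hf, hM⟩ := exists_ker_jac (e 2 - e 0) (1 - (e 2 - e 0) - (e 5 - e 3))
    ((1 - g) / 2) ((1 + g) / 2) k
  refine ⟨f, hf, ?_⟩
  set κ := 1 - (e 2 - e 0) - (e 5 - e 3) with hκ
  obtain ⟨s, hs⟩ : ∃ s, s = sOf e := ⟨_, rfl⟩
  obtain ⟨n, hn⟩ : ∃ n : ℂ, n = (2 * k : ℕ) := ⟨_, rfl⟩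
  rw [← hs, ← hn] at hk
  rw [← hn] at hM
  have e6 : e 6 = 1 - n - s - e 0 - e 3 := by linear_combination hk
  have e1 : e 1 = (e 0 + e 2 - g) / 2 := by linear_combination -h0 / 2
  have e4 : e 4 = (e 3 + e 5 - g) / 2 := by linear_combination -h1 / 2
  have e8 : e 8 = 4 - 2 * s + g - e 0 - e 2 - e 3 - e 5 - e 6 := by
    rw [sOf, sym1, sym1, sym1] at hs
    linear_combination 2 * hs + (h0 + h1 + h2) / 3
  have e7 : e 7 = (e 6 + e 8 - g) / 2 := by linear_combination -h2 / 2
  set w := -((1 - g) / 2 * jacEigen κ n + (1 + g) / 2 * jacEigen κ (n + 1)) with hw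
  have hA : triA e = fun m => -1 / 2 * jacA κ ((1 - g) / 2) ((1 + g) / 2) w m := by
    funext m
    simp only [triA, b0, qOf, jacA, hw, hκ, jacEigen, ← hs, e7, e8, e6]
    ring
  have hB : triB e = fun m => -1 / 2 * jacB (e 2 - e 0) κ ((1 - g) / 2) ((1 + g) / 2) w m := by
    funext m
    simp only [triB, b2, b3, qOf, jacB, hw, hκ, jacEigen, ← hs, e7, e8, e6, e1, e4, coeffT10,
      coeffT20, coeffT21, sym1, sym2, sym3]
    ring
  have hC : triC e = fun m => -1 / 2 * jacC (e 2 - e 0) ((1 - g) / 2) ((1 + g) / 2) m := by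
    funext m
    simp only [triC, b3, jacC, e1]
    ring
  rw [hA, hB, hC, triMat_mul, Matrix.smul_mulVec, hM, smul_zero]

/-- If the sum of the three middle exponents, listed first here, is a nonpositive even integer, the
reduced operator is antisymmetric for the invariant form. -/
theorem isReducible_of_middle_neg {e : Fin 9 → ℂ} {g : ℂ} (h0 : e 1 - 2 * e 0 + e 2 = g)
    (h1 : e 4 - 2 * e 3 + e 5 = g) (h2 : e 7 - 2 * e 6 + e 8 = g) {k : ℕ}
    (hk : e 0 + e 3 + e 6 + sOf e - 1 = -(2 * k : ℕ)) : IsReducible (E6v e) := by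
  refine isReducible_of_triMat hk (exists_ker_of_antisymm (even_two_mul k) ?_ ?_ ?_)
  all_goals
    obtain ⟨s, hs⟩ : ∃ s, s = sOf e := ⟨_, rfl⟩
    obtain ⟨n, hn⟩ : ∃ n : ℂ, n = (2 * k : ℕ) := ⟨_, rfl⟩
    rw [← hs, ← hn] at hk
    rw [← hn]
    have e2 : e 2 = g + 2 * e 0 - e 1 := by linear_combination h0
    have e5 : e 5 = g + 2 * e 3 - e 4 := by linear_combination h1
    have e8 : e 8 = g + 2 * e 6 - e 7 := by linear_combination h2
    have e6 : e 6 = 1 - s - n - e 0 - e 3 := by linear_combination hk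
    -- the Fuchs relation
    have hg : g = n + 1 := by
      rw [sOf, sym1, sym1, sym1, e2, e5, e8, e6] at hs
      linear_combination hs
    intro m
  · simp only [triA, b0, qOf, ← hs, e8, e6, hg]
    ring
  · simp only [triB, b2, b3, qOf, ← hs, e8, e6, e2, e5, hg, coeffT10, coeffT20, coeffT21, sym1,
      sym2, sym3]
    ring
  · simp only [triC, b3, e2, hg]
    ring

/-- Passage to the adjoint replaces the sum `t = e₁ + e₄ + e₇ + s - 1` by `2 - t`, so only the
nonpositive even sums matter. -/
theorem isReducible_of_sum_dual {e : Fin 9 → ℂ}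
    (hneg : ∀ e' : Fin 9 → ℂ, (e' = e ∨ e' = dualExp e) →
      ∀ k : ℕ, e' 0 + e' 3 + e' 6 + sOf e' - 1 = -(2 * k : ℕ) → IsReducible (E6v e'))
    (hz : IsInt ((e 0 + e 3 + e 6 + sOf e - 1) / 2)) : IsReducible (E6v e) := by
  obtain ⟨z, hz⟩ := hz
  rcases le_or_gt z 0 with h | h
  · obtain ⟨k, rfl⟩ : ∃ k : ℕ, z = -k := ⟨z.natAbs, by omega⟩
    refine hneg e (Or.inl rfl) k ?_
    push_cast at hz ⊢
    linear_combination 2 * hz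
  · obtain ⟨k, rfl⟩ : ∃ k : ℕ, z = k + 1 := ⟨(z - 1).natAbs, by omega⟩
    refine isReducible_of_dualExp (hneg _ (Or.inr rfl) k ?_)
    rw [sOf_dualExp]
    simp only [dualExp, Matrix.cons_val]
    push_cast at hz ⊢
    linear_combination -2 * hz

/-- The sum of the first exponents of the three triples is even, up to `s - 1`. -/
theorem isReducible_of_extreme_zero {e : Fin 9 → ℂ} {g : ℂ} (h0 : e 0 - 2 * e 1 + e 2 = g)
    (h1 : e 3 - 2 * e 4 + e 5 = g) (h2 : e 6 - 2 * e 7 + e 8 = g)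
    (hz : IsInt ((e 0 + e 3 + e 6 + sOf e - 1) / 2)) : IsReducible (E6v e) := by
  refine isReducible_of_sum_dual ?_ hz
  rintro _ (rfl | rfl) k hk
  · exact isReducible_of_extreme_neg h0 h1 h2 hk
  · refine isReducible_of_extreme_neg (g := -g) ?_ ?_ ?_ hk <;>
      simp only [dualExp, Matrix.cons_val]
    · linear_combination -h0
    · linear_combination -h1
    · linear_combination -h2

/-- The first and the last exponent of each triple play the same role. -/
theorem isReducible_of_extreme {e : Fin 9 → ℂ} {g : ℂ} (h0 : e 0 - 2 * e 1 + e 2 = g)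
    (h1 : e 3 - 2 * e 4 + e 5 = g) (h2 : e 6 - 2 * e 7 + e 8 = g) {i j k : Fin 9}
    (hi : i = 0 ∨ i = 2) (hj : j = 3 ∨ j = 5) (hk : k = 6 ∨ k = 8)
    (hz : IsInt ((e i + e j + e k + sOf e - 1) / 2)) : IsReducible (E6v e) := by
  have hi' : ∀ l : Fin 9, (Equiv.swap 0 i l).val / 3 = l.val / 3 := by
    rcases hi with rfl | rfl <;> decide
  have hj' : ∀ l : Fin 9, (Equiv.swap 3 j l).val / 3 = l.val / 3 := by
    rcases hj with rfl | rfl <;> decide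
  have hk' : ∀ l : Fin 9, (Equiv.swap 6 k l).val / 3 = l.val / 3 := by
    rcases hk with rfl | rfl <;> decide
  obtain ⟨hs, hE⟩ := E6v_comp_perm e (σ := Equiv.swap 0 i * Equiv.swap 3 j * Equiv.swap 6 k)
    fun l => by rw [Equiv.Perm.mul_apply, Equiv.Perm.mul_apply, hi', hj', hk']
  rw [← hE]
  refine isReducible_of_extreme_zero (g := g) ?_ ?_ ?_ ?_
  · rcases hi with rfl | rfl <;> rcases hj with rfl | rfl <;> rcases hk with rfl | rfl <;>
      simp [Equiv.swap_apply_def] <;> linear_combination h0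
  · rcases hi with rfl | rfl <;> rcases hj with rfl | rfl <;> rcases hk with rfl | rfl <;>
      simp [Equiv.swap_apply_def] <;> linear_combination h1
  · rcases hi with rfl | rfl <;> rcases hj with rfl | rfl <;> rcases hk with rfl | rfl <;>
      simp [Equiv.swap_apply_def] <;> linear_combination h2
  · rw [hs]
    convert hz using 6
    all_goals
      rcases hi with rfl | rfl <;> rcases hj with rfl | rfl <;> rcases hk with rfl | rfl <;>
        simp [Equiv.swap_apply_def]

/-- The sum of the three middle exponents is even, up to `s - 1`. -/
theorem isReducible_of_middle {e : Fin 9 → ℂ} {g : ℂ} (h0 : e 0 - 2 * e 1 + e 2 = g)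
    (h1 : e 3 - 2 * e 4 + e 5 = g) (h2 : e 6 - 2 * e 7 + e 8 = g)
    (hz : IsInt ((e 1 + e 4 + e 7 + sOf e - 1) / 2)) : IsReducible (E6v e) := by
  obtain ⟨hs, hE⟩ := E6v_comp_perm e (σ := Equiv.swap 0 1 * Equiv.swap 3 4 * Equiv.swap 6 7)
    (by decide)
  have hv : e ∘ (Equiv.swap 0 1 * Equiv.swap 3 4 * Equiv.swap 6 7 : Equiv.Perm (Fin 9)) =
      ![e 1, e 0, e 2, e 4, e 3, e 5, e 7, e 6, e 8] := by
    funext i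
    fin_cases i <;> rfl
  rw [hv] at hs hE
  rw [← hE]
  refine isReducible_of_sum_dual ?_ (by rw [hs]; exact hz)
  rintro _ (rfl | rfl) k hk
  · exact isReducible_of_middle_neg (g := g) h0 h1 h2 hk
  · refine isReducible_of_middle_neg (g := -g) ?_ ?_ ?_ hk <;>
      simp only [dualExp, Matrix.cons_val]
    · linear_combination -h0
    · linear_combination -h1
    · linear_combination -h2

/-- All exponents at `0` and at `1` are treated alike, by the symmetries of `E₆`. -/
theorem isReducible_of_isInt_finite (e : Fin 9 → ℂ) {i : Fin 9} (hi : i.val < 6)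
    (h : IsInt (e i + sOf e)) : IsReducible (E6v e) := by
  have hzero : ∀ (e : Fin 9 → ℂ) (i : Fin 9), i.val < 3 → IsInt (e i + sOf e) →
      IsReducible (E6v e) := by
    intro e i hi h
    obtain ⟨hs, hE⟩ := E6v_comp_perm e (σ := Equiv.swap 0 i) (by
      clear h
      decide +revert)
    rw [← hE]
    refine isReducible_of_isInt_zero _ ?_
    rwa [hs, Function.comp_apply, Equiv.swap_apply_left]
  rcases lt_or_ge i.val 3 with h3 | h3
  · exact hzero e i h3 h
  · refine isReducible_of_swapExp (hzero _ ⟨i.val - 3, by omega⟩ (by dsimp only; omega) ?_)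
    rw [sOf_swapExp]
    convert h using 2
    fin_cases i <;> first | rfl | (exfalso; simp at hi h3)

end Even

end FuchsSE6

open FuchsSE6 in
theorem mainTheorem1 (a b c g p q r : ℂ)
    (h : FuchsSE6.IsInt a ∨ FuchsSE6.IsInt b ∨ FuchsSE6.IsInt c ∨
      FuchsSE6.IsInt ((g - 1) / 2) ∨ FuchsSE6.IsInt ((2 * a + g) / 2) ∨
      FuchsSE6.IsInt ((2 * b + g) / 2) ∨ FuchsSE6.IsInt ((2 * c + g) / 2) ∨
      FuchsSE6.IsInt (a + b + c + g) ∨ FuchsSE6.IsInt ((2 * a + 2 * b + 2 * c + g) / 2) ∨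
      FuchsSE6.IsInt r ∨
      (∃ i : Fin 9, i.val < 6 ∧ FuchsSE6.IsInt (FuchsSE6.exps a b c g p q r i - r)) ∨
      (∃ i : Fin 9, 6 ≤ i.val ∧ FuchsSE6.IsInt (FuchsSE6.exps a b c g p q r i))) :
    FuchsSE6.IsReducible (FuchsSE6.SE6 a b c g p q r) := by
  obtain ⟨e, he⟩ : ∃ e, e = exps a b c g p q r := ⟨_, rfl⟩
  have hE : SE6 a b c g p q r = E6v e := by rw [he]; rfl
  have v0 : e 0 = p + r + 1 := by rw [he]; rfl
  have v1 : e 1 = a + c + p + r + 2 := by rw [he]; rfl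
  have v2 : e 2 = 2 * a + 2 * c + g + p + r + 3 := by rw [he]; rfl
  have v3 : e 3 = q + r + 1 := by rw [he]; rfl
  have v4 : e 4 = b + c + q + r + 2 := by rw [he]; rfl
  have v5 : e 5 = 2 * b + 2 * c + g + q + r + 3 := by rw [he]; rfl
  have v6 : e 6 = -2 * c - (p + q + r) - 1 := by rw [he]; rfl
  have v7 : e 7 = -a - b - 2 * c - (p + q + r + g) - 2 := by rw [he]; rfl
  have v8 : e 8 = -2 * a - 2 * b - 2 * c - (p + q + r + g) - 3 := by rw [he]; rfl
  have hs : sOf e = -r := by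
    rw [sOf, sym1, sym1, sym1, v0, v1, v2, v3, v4, v5, v6, v7, v8]
    ring
  have h0 : e 0 - 2 * e 1 + e 2 = g := by rw [v0, v1, v2]; ring
  have h1 : e 3 - 2 * e 4 + e 5 = g := by rw [v3, v4, v5]; ring
  have h2 : e 6 - 2 * e 7 + e 8 = g := by rw [v6, v7, v8]; ring
  have hneg : ∀ {x y : ℂ} (m : ℤ), IsInt x → y = m - x → IsInt y := by
    rintro x y m ⟨n, rfl⟩ rfl
    exact ⟨m - n, by push_cast; rfl⟩
  have hpos : ∀ {x y : ℂ} (m : ℤ), IsInt x → y = m + x → IsInt y := by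
    rintro x y m ⟨n, rfl⟩ rfl
    exact ⟨m + n, by push_cast; rfl⟩
  rw [hE]
  rw [← he] at h
  rcases h with h | h | h | h | h | h | h | h | h | h | ⟨i, hi, h⟩ | ⟨i, hi, h⟩
  · refine isReducible_of_extreme h0 h1 h2 (i := 0) (j := 5) (k := 8) (by simp) (by simp) (by simp)
      (hneg 0 h ?_)
    rw [hs, v0, v5, v8]; push_cast; ring
  · refine isReducible_of_extreme h0 h1 h2 (i := 2) (j := 3) (k := 8) (by simp) (by simp) (by simp)
      (hneg 0 h ?_)
    rw [hs, v2, v3, v8]; push_cast; ring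
  · refine isReducible_of_extreme h0 h1 h2 (i := 0) (j := 3) (k := 6) (by simp) (by simp) (by simp)
      (hneg 0 h ?_)
    rw [hs, v0, v3, v6]; push_cast; ring
  · refine isReducible_of_middle h0 h1 h2 (hneg 0 h ?_)
    rw [hs, v1, v4, v7]; push_cast; ring
  · refine isReducible_of_extreme h0 h1 h2 (i := 2) (j := 3) (k := 6) (by simp) (by simp) (by simp)
      (hpos 1 h ?_)
    rw [hs, v2, v3, v6]; push_cast; ring
  · refine isReducible_of_extreme h0 h1 h2 (i := 0) (j := 5) (k := 6) (by simp) (by simp) (by simp)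
      (hpos 1 h ?_)
    rw [hs, v0, v5, v6]; push_cast; ring
  · refine isReducible_of_extreme h0 h1 h2 (i := 2) (j := 5) (k := 8) (by simp) (by simp) (by simp)
      (hpos 1 h ?_)
    rw [hs, v2, v5, v8]; push_cast; ring
  · refine isReducible_of_extreme h0 h1 h2 (i := 2) (j := 5) (k := 6) (by simp) (by simp) (by simp)
      (hpos 2 h ?_)
    rw [hs, v2, v5, v6]; push_cast; ring
  · refine isReducible_of_extreme h0 h1 h2 (i := 0) (j := 3) (k := 8) (by simp) (by simp) (by simp)
      (hneg (-1) h ?_)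
    rw [hs, v0, v3, v8]; push_cast; ring
  · exact isReducible_of_isInt_infty e (Or.inl (hneg 0 h (by rw [hs]; push_cast; ring)))
  · exact isReducible_of_isInt_finite e hi (by rwa [hs, ← sub_eq_add_neg])
  · refine isReducible_of_isInt_infty e (Or.inr ?_)
    obtain rfl | rfl | rfl : i = 6 ∨ i = 7 ∨ i = 8 := by
      simp only [Fin.ext_iff, Fin.isValue, Fin.coe_ofNat_eq_mod]
      omega
    · exact Or.inl h
    · exact Or.inr (Or.inl h)
    · exact Or.inr (Or.inr h)

end
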